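/- Let $M$ be a smooth, finite-dimensional, Hausdorff, paracompact real manifold, $n\ge 1$, and let $E\to M$ be a smooth complex vector bundle with fibre $\mathbb C^n$ and structure group $SU(n)$ (so that $E$ carries a hermitian structure and a complex volume form). Let $C^\infty(M)$ be the algebra of smooth complex-valued functions, $\Gamma(TM)=\mathrm{Der}(C^\infty(M))$ the (complexified) vector fields, $A=\Gamma(\mathrm{End}\,E)$, whose centre is $C^\infty(M)\cdot 1$, $A_0\subset A$ the trace-free elements, $\mathrm{ad}_\gamma(a)=\gamma a-a\gamma$, and $\rho:\mathrm{Der}(A)\to\Gamma(TM)$ the restriction of derivations to the centre. A connection $\nabla$ on $E$ induces, for each $X\in\Gamma(TM)$, a derivation of $A$, still written $\nabla_X$, by $(\nabla_Xa)s=\nabla_X(as)-a\nabla_Xs$; call $\nabla$ special if it preserves the volume form of $E$, i.e. if its local connection forms have values in $\mathfrak{sl}(n,\mathbb C)$. A connection form of $\nabla$ is a $C^\infty(M)$-linear map $\alpha:\mathrm{Der}(A)\to A_0$ with $\mathcal X=\nabla_{\rho(\mathcal X)}-\mathrm{ad}_{\alpha(\mathcal X)}$ for all $\mathcal X\in\mathrm{Der}(A)$.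 A metric on a $C^\infty(M)$-module $P$ is a symmetric $C^\infty(M)$-bilinear map $h:P\times P\to C^\infty(M)$ such that $p\mapsto h(p,\cdot)$ is injective. Let $h$ be a metric on $\mathrm{Der}(A)$ whose inner metric $h_{\mathrm{Int}}(\gamma,\delta)=h(\mathrm{ad}_\gamma,\mathrm{ad}_\delta)$ on $A_0$ is nondegenerate at every point of $M$: if $h_{\mathrm{Int}}(\gamma,\eta)(x)=0$ for all $\eta\in A_0$, then $\gamma(x)=0$ (equivalently, the matrix of $h_{\mathrm{Int}}$ in a local frame of trace-free endomorphisms is invertible). Then there is a unique special connection $\nabla$ on $E$ such that $$h(\nabla_X,\mathrm{ad}_\gamma)=0\qquad\text{for all }X\in\Gamma(TM),\ \gamma\in A.$$ Every connection on $E$, special or not, with this property induces the same connection on $\mathrm{End}\,E$; and if $h$ is real (real-valued on the derivations that commute with $a\mapsto a^*$), then $\nabla$ also preserves the hermitian structure, i.e. it is an $SU(n)$-connection. Consequently, $\nabla$ has a unique connection form $\alpha$, and $$h=\rho^*h^M+\alpha^*h_{\mathrm{Int}},\qquad h^M(X,Y)=h(\nabla_X,\nabla_Y),$$ that is, $h(\mathcal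 X,\mathcal Y)=h^M(\rho(\mathcal X),\rho(\mathcal Y))+h_{\mathrm{Int}}(\alpha(\mathcal X),\alpha(\mathcal Y))$, where $h^M$ is a metric on $\Gamma(TM)$; if $h$ is nondegenerate at every point of $M$, so is $h^M$. (At a point $x$, the value of $\mathcal X\in\mathrm{Der}(A)$ is $a\mapsto(\mathcal Xa)(x)$, that of $X\in\Gamma(TM)$ is $f\mapsto(Xf)(x)$, and a form is nondegenerate at $x$ if $h(\mathcal X,\mathcal Y)(x)=0$ for all $\mathcal Y$ implies that the value of $\mathcal X$ at $x$ is $0$.) This decomposition is unique: if $h=\rho^*g+\alpha'^*\mu$ with $\alpha'$ a connection form of a special connection $\nabla'$, and $g$, $\mu$ $C^\infty(M)$-bilinear forms on $\Gamma(TM)$ and $A_0$, then $\nabla'=\nabla$, $\alpha'=\alpha$, $g=h^M$ and $\mu=h_{\mathrm{Int}}$. -/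

import Mathlib

open Bundle
open scoped Manifold ContDiff

namespace EndBundle

/-! ### Functions and vector fields -/

instance contMDiffRing_complex : ContMDiffRing 𝓘(ℝ, ℂ) ∞ ℂ where
  contMDiff_mul := by
    rw [contMDiff_iff]
    refine ⟨continuous_mul, fun x y => ?_⟩
    simp only [mfld_simps, chartAt_self_eq]
    rw [contDiffOn_univ]
    exact contDiff_mul

section Functions

variable (m : ℕ) (M : Type*) [TopologicalSpace M] [ChartedSpace (EuclideanSpace ℝ (Fin m)) M]

/-- The subalgebra of smooth functions among all functions `M → ℂ`. -/
def smoothFunctions : Subalgebra ℂ (M → ℂ) where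
  carrier := {f | ContMDiff (𝓡 m) 𝓘(ℝ, ℂ) ∞ f}
  mul_mem' hf hg := ContMDiff.mul hf hg
  add_mem' hf hg := ContMDiff.add hf hg
  algebraMap_mem' _ := contMDiff_const

/-- The algebra `C^∞(M)` of smooth complex-valued functions on the real manifold `M`. -/
def SmoothFun : Type _ := smoothFunctions m M

instance : CommRing (SmoothFun m M) := inferInstanceAs (CommRing (smoothFunctions m M))
instance : Algebra ℂ (SmoothFun m M) := inferInstanceAs (Algebra ℂ (smoothFunctions m M))
instance : CoeFun (SmoothFun m M) fun _ => M → ℂ := ⟨fun f => f.1⟩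

/-- `Γ(TM) = Der(C^∞(M))`: the (complexified) smooth vector fields on `M`, as derivations of the
algebra of smooth complex-valued functions. -/
abbrev VectorField := Derivation ℂ (SmoothFun m M) (SmoothFun m M)

variable {m M}

/-- A smooth function with real values. -/
def IsRealFun (f : SmoothFun m M) : Prop := ∀ x, (f x).im = 0

/-- A real vector field: it maps real-valued functions to real-valued functions. -/
def IsRealField (X : VectorField m M) : Prop := ∀ f, IsRealFun f → IsRealFun (X f)

end Functions

/-! ### Symmetric bilinear forms over `C^∞(M)` -/

section Forms

variable {m : ℕ} {M : Type*} [TopologicalSpace M] [ChartedSpace (EuclideanSpace ℝ (Fin m)) M]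
  {P : Type*} [AddCommGroup P] [Module (SmoothFun m M) P]

/-- A (pseudo-)metric on a `C^∞(M)`-module `P`: a symmetric `C^∞(M)`-bilinear form
`h : P × P → C^∞(M)` such that `h^♭ : p ↦ h(p, ·)` is injective. -/
def IsMetric (h : LinearMap.BilinForm (SmoothFun m M) P) : Prop :=
  (∀ p q, h p q = h q p) ∧ Function.Injective h

/-- The pull-back `φ^*h (p, q) = h(φ(p), φ(q))` of a bilinear form. -/
def pullback {Q : Type*} [AddCommGroup Q] [Module (SmoothFun m M) Q] (φ : P →ₗ[SmoothFun m M] Q)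
    (h : LinearMap.BilinForm (SmoothFun m M) Q) : LinearMap.BilinForm (SmoothFun m M) P :=
  h.compl₁₂ φ φ

end Forms

/-! ### Smooth complex vector bundles with `SU(n)`-structure -/

section Bundles

variable {m : ℕ} {M : Type*} [TopologicalSpace M] {n : ℕ} {E : M → Type*}
  [∀ x, AddCommGroup (E x)] [∀ x, Module ℂ (E x)] [∀ x, TopologicalSpace (E x)]
  [TopologicalSpace (TotalSpace (Fin n → ℂ) E)] [FiberBundle (Fin n → ℂ) E]
  [VectorBundle ℂ (Fin n → ℂ) E]

/-- The transition matrix `E_x ≅ ℂⁿ (via e)` to `E_x ≅ ℂⁿ (via e')`. -/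
noncomputable def transition (e e' : Trivialization (Fin n → ℂ) (π (Fin n → ℂ) E))
    [MemTrivializationAtlas e] [MemTrivializationAtlas e'] (x : M) : Matrix (Fin n) (Fin n) ℂ :=
  LinearMap.toMatrix' (e'.linearMapAt ℂ x ∘ₗ e.symmₗ ℂ x)

/-- The matrix, in the trivialization `e`, of an endomorphism of the fibre `E_x`. -/
noncomputable def endMatrix (e : Trivialization (Fin n → ℂ) (π (Fin n → ℂ) E))
    [MemTrivializationAtlas e] (x : M) (a : Module.End ℂ (E x)) : Matrix (Fin n) (Fin n) ℂ :=
  LinearMap.toMatrix' (e.linearMapAt ℂ x ∘ₗ a ∘ₗ e.symmₗ ℂ x)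

variable (m n E) in
/-- The complex vector bundle `E` of fibre `ℂⁿ` is smooth with structure group `SU(n)`: the
transition functions of its atlas of trivializations are smooth with values in `SU(n)`. -/
class SUStructure [ChartedSpace (EuclideanSpace ℝ (Fin m)) M] : Prop where
  smooth : ∀ (e e' : Trivialization (Fin n → ℂ) (π (Fin n → ℂ) E))
    [MemTrivializationAtlas e] [MemTrivializationAtlas e'] (i j : Fin n),
    ContMDiffOn (𝓡 m) 𝓘(ℝ, ℂ) ∞ (fun x => transition e e' x i j) (e.baseSet ∩ e'.baseSet)
  special : ∀ (e e' : Trivialization (Fin n → ℂ) (π (Fin n → ℂ) E))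
    [MemTrivializationAtlas e] [MemTrivializationAtlas e'] (x : M),
    x ∈ e.baseSet ∩ e'.baseSet → transition e e' x ∈ Matrix.specialUnitaryGroup (Fin n) ℂ

variable (n) in
/-- The hermitian structure of `E` given by the `SU(n)`-structure (antilinear on the left). -/
noncomputable def hermAt (x : M) (v w : E x) : ℂ :=
  star ((trivializationAt (Fin n → ℂ) E x).linearMapAt ℂ x v) ⬝ᵥ
    (trivializationAt (Fin n → ℂ) E x).linearMapAt ℂ x w

/-- The complex volume form of `E` given by the `SU(n)`-structure. -/
noncomputable def volAt (x : M) (v : Fin n → E x) : ℂ :=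
  (Matrix.of fun i j => (trivializationAt (Fin n → ℂ) E x).linearMapAt ℂ x (v j) i).det

lemma linearMapAt_eq_transition (e e' : Trivialization (Fin n → ℂ) (π (Fin n → ℂ) E))
    [MemTrivializationAtlas e] [MemTrivializationAtlas e'] {x : M} (hx : x ∈ e.baseSet) (v : E x) :
    e'.linearMapAt ℂ x v = (transition e e' x).mulVec (e.linearMapAt ℂ x v) := by
  rw [transition, ← Matrix.toLin'_apply, Matrix.toLin'_toMatrix', LinearMap.comp_apply,
    Trivialization.symmₗ_linearMapAt _ hx]

lemma linearMapAt_end (e : Trivialization (Fin n → ℂ) (π (Fin n → ℂ) E))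
    [MemTrivializationAtlas e] {x : M} (hx : x ∈ e.baseSet) (a : Module.End ℂ (E x)) (v : E x) :
    e.linearMapAt ℂ x (a v) = (endMatrix e x a).mulVec (e.linearMapAt ℂ x v) := by
  rw [endMatrix, ← Matrix.toLin'_apply, Matrix.toLin'_toMatrix', LinearMap.comp_apply,
    LinearMap.comp_apply, Trivialization.symmₗ_linearMapAt _ hx]

lemma endMatrix_mul (e : Trivialization (Fin n → ℂ) (π (Fin n → ℂ) E))
    [MemTrivializationAtlas e] {x : M} (hx : x ∈ e.baseSet) (a b : Module.End ℂ (E x)) :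
    endMatrix e x (a * b) = endMatrix e x a * endMatrix e x b := by
  rw [endMatrix, endMatrix, endMatrix, ← LinearMap.toMatrix'_comp]
  congr 1
  refine LinearMap.ext fun v => ?_
  simp only [LinearMap.comp_apply, Module.End.mul_apply]
  rw [Trivialization.symmₗ_linearMapAt _ hx]

lemma endMatrix_add (e : Trivialization (Fin n → ℂ) (π (Fin n → ℂ) E))
    [MemTrivializationAtlas e] (x : M) (a b : Module.End ℂ (E x)) :
    endMatrix e x (a + b) = endMatrix e x a + endMatrix e x b := by
  simp only [endMatrix, LinearMap.add_comp, LinearMap.comp_add, map_add]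

lemma endMatrix_smul_one (e : Trivialization (Fin n → ℂ) (π (Fin n → ℂ) E))
    [MemTrivializationAtlas e] {x : M} (hx : x ∈ e.baseSet) (c : ℂ) :
    endMatrix e x (algebraMap ℂ (Module.End ℂ (E x)) c) = c • (1 : Matrix (Fin n) (Fin n) ℂ) := by
  rw [endMatrix, ← LinearMap.toMatrix'_id, ← map_smul]
  congr 1
  refine LinearMap.ext fun v => ?_
  simp only [LinearMap.comp_apply, Module.algebraMap_end_apply, map_smul]
  rw [Trivialization.linearMapAt_symmₗ _ hx]
  rfl

lemma trace_eq_endMatrix (e : Trivialization (Fin n → ℂ) (π (Fin n → ℂ) E))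
    [MemTrivializationAtlas e] {x : M} (hx : x ∈ e.baseSet) (a : Module.End ℂ (E x)) :
    LinearMap.trace ℂ (E x) a = (endMatrix e x a).trace := by
  rw [endMatrix, ← LinearMap.toMatrix_eq_toMatrix',
    ← LinearMap.trace_eq_matrix_trace, ← LinearMap.trace_conj' a (e.linearEquivAt ℂ x hx)]
  congr 1
  refine LinearMap.ext fun v => ?_
  simp [LinearEquiv.conj_apply, hx]

variable [ChartedSpace (EuclideanSpace ℝ (Fin m)) M]

/-- The hermitian structure may be computed in any trivialization of the atlas. -/
lemma hermAt_eq [SUStructure m n E] (e : Trivialization (Fin n → ℂ) (π (Fin n → ℂ) E))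
    [MemTrivializationAtlas e] {x : M} (hx : x ∈ e.baseSet) (v w : E x) :
    hermAt n x v w = star (e.linearMapAt ℂ x v) ⬝ᵥ e.linearMapAt ℂ x w := by
  have hx' := FiberBundle.mem_baseSet_trivializationAt' (F := Fin n → ℂ) (E := E) x
  have hg := SUStructure.special (m := m) e (trivializationAt (Fin n → ℂ) E x) x ⟨hx, hx'⟩
  have hu := Matrix.mem_unitaryGroup_iff'.1 (Matrix.mem_specialUnitaryGroup_iff.1 hg).1
  rw [hermAt, linearMapAt_eq_transition e (trivializationAt (Fin n → ℂ) E x) hx v,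
    linearMapAt_eq_transition e (trivializationAt (Fin n → ℂ) E x) hx w,
    Matrix.star_mulVec, Matrix.dotProduct_mulVec, Matrix.vecMul_vecMul,
    ← Matrix.star_eq_conjTranspose, hu, Matrix.vecMul_one]

/-- The volume form may be computed in any trivialization of the atlas. -/
lemma volAt_eq [SUStructure m n E] (e : Trivialization (Fin n → ℂ) (π (Fin n → ℂ) E))
    [MemTrivializationAtlas e] {x : M} (hx : x ∈ e.baseSet) (v : Fin n → E x) :
    volAt x v = (Matrix.of fun i j => e.linearMapAt ℂ x (v j) i).det := by
  have hx' := FiberBundle.mem_baseSet_trivializationAt' (F := Fin n → ℂ) (E := E) x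
  have hg := SUStructure.special (m := m) e (trivializationAt (Fin n → ℂ) E x) x ⟨hx, hx'⟩
  have hd := (Matrix.mem_specialUnitaryGroup_iff.1 hg).2
  have h : (Matrix.of fun i j => (trivializationAt (Fin n → ℂ) E x).linearMapAt ℂ x (v j) i) =
      transition e (trivializationAt (Fin n → ℂ) E x) x *
        Matrix.of fun i j => e.linearMapAt ℂ x (v j) i := by
    ext i j
    rw [Matrix.of_apply, linearMapAt_eq_transition e _ hx]
    rfl
  rw [volAt, h, Matrix.det_mul, hd, one_mul]

variable (m n E) in
/-- The smooth sections of `E` among all sections. -/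
def smoothSections : Submodule (smoothFunctions m M) (∀ x, E x) where
  carrier := {s | ∀ (e : Trivialization (Fin n → ℂ) (π (Fin n → ℂ) E)) [MemTrivializationAtlas e]
    (i : Fin n), ContMDiffOn (𝓡 m) 𝓘(ℝ, ℂ) ∞ (fun x => e.linearMapAt ℂ x (s x) i) e.baseSet}
  add_mem' {s t} hs ht e _ i :=
    ((hs e i).add (ht e i)).congr fun x _ => by
      rw [Pi.add_apply, map_add]
      rfl
  zero_mem' e _ i := by
    refine (contMDiffOn_const (c := (0 : ℂ))).congr fun x _ => ?_
    rw [Pi.zero_apply, map_zero]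
    rfl
  smul_mem' f s hs e _ i := by
    have hf : ContMDiffOn (𝓡 m) 𝓘(ℝ, ℂ) ∞ (f : M → ℂ) e.baseSet := ContMDiff.contMDiffOn f.2
    refine (ContMDiffOn.mul hf (hs e i)).congr fun x _ => ?_
    change e.linearMapAt ℂ x ((f : M → ℂ) x • s x) i = _
    rw [map_smul]
    rfl

variable (m n E) in
/-- The `C^∞(M)`-module `Γ(E)` of smooth sections of `E`. -/
def Sections : Type _ := smoothSections m n E

instance : AddCommGroup (Sections m n E) := inferInstanceAs (AddCommGroup (smoothSections m n E))
instance : Module (SmoothFun m M) (Sections m n E) :=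
  inferInstanceAs (Module (smoothFunctions m M) (smoothSections m n E))
instance : Module ℂ (Sections m n E) := inferInstanceAs (Module ℂ (smoothSections m n E))
instance : IsScalarTower ℂ (SmoothFun m M) (Sections m n E) :=
  inferInstanceAs (IsScalarTower ℂ (smoothFunctions m M) (smoothSections m n E))
instance : CoeFun (Sections m n E) fun _ => ∀ x, E x := ⟨fun s => s.1⟩

variable (m n E) in
/-- The smooth sections of the bundle of (complex linear) endomorphisms of `E`. -/
def smoothEnd : Subalgebra (smoothFunctions m M) (∀ x, Module.End ℂ (E x)) where
  carrier := {a | ∀ (e : Trivialization (Fin n → ℂ) (π (Fin n → ℂ) E)) [MemTrivializationAtlas e]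
    (i j : Fin n), ContMDiffOn (𝓡 m) 𝓘(ℝ, ℂ) ∞ (fun x => endMatrix e x (a x) i j) e.baseSet}
  mul_mem' {a b} ha hb e _ i j := by
    refine (contMDiffOn_finsetSum (t := Finset.univ)
      fun k _ => (ha e i k).mul (hb e k j)).congr fun x hx => ?_
    rw [Pi.mul_apply, endMatrix_mul e hx, Matrix.mul_apply]
    rfl
  add_mem' {a b} ha hb e _ i j := by
    refine ((ha e i j).add (hb e i j)).congr fun x _ => ?_
    rw [Pi.add_apply, endMatrix_add]
    rfl
  algebraMap_mem' f e _ i j := by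
    have hf : ContMDiffOn (𝓡 m) 𝓘(ℝ, ℂ) ∞ (f : M → ℂ) e.baseSet := ContMDiff.contMDiffOn f.2
    refine (ContMDiffOn.mul hf (contMDiffOn_const
      (c := (1 : Matrix (Fin n) (Fin n) ℂ) i j))).congr fun x hx => ?_
    change endMatrix e x (algebraMap ℂ (Module.End ℂ (E x)) ((f : M → ℂ) x)) i j = _
    rw [endMatrix_smul_one e hx]
    rfl

variable (m n E) in
/-- The algebra `A = Γ(End E)` of smooth sections of the endomorphism bundle of `E`. -/
def EndAlg : Type _ := smoothEnd m n E

instance : Ring (EndAlg m n E) := inferInstanceAs (Ring (smoothEnd m n E))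
instance : Algebra (SmoothFun m M) (EndAlg m n E) :=
  inferInstanceAs (Algebra (smoothFunctions m M) (smoothEnd m n E))
instance : Algebra ℂ (EndAlg m n E) := inferInstanceAs (Algebra ℂ (smoothEnd m n E))
instance : IsScalarTower ℂ (SmoothFun m M) (EndAlg m n E) :=
  inferInstanceAs (IsScalarTower ℂ (smoothFunctions m M) (smoothEnd m n E))
instance : CoeFun (EndAlg m n E) fun _ => ∀ x, Module.End ℂ (E x) := ⟨fun a => a.1⟩

/-- `(a s)(x) = a(x) s(x)`, for `a ∈ A` and `s ∈ Γ(E)`. -/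
def applySection (a : EndAlg m n E) (s : Sections m n E) : Sections m n E :=
  ⟨fun x => a.1 x (s.1 x), fun e _ i => by
    refine (contMDiffOn_finsetSum (t := Finset.univ)
      fun k _ => (a.2 e i k).mul (s.2 e k)).congr fun x hx => ?_
    rw [linearMapAt_end e hx]
    rfl⟩

/-- The action of `A` on `Γ(E)` by `C^∞(M)`-linear endomorphisms. -/
def toEnd : EndAlg m n E →ₐ[SmoothFun m M] Module.End (SmoothFun m M) (Sections m n E) where
  toFun a :=
    { toFun := applySection a
      map_add' := fun _ _ => Subtype.ext <| funext fun x => (a.1 x).map_add _ _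
      map_smul' := fun _ _ => Subtype.ext <| funext fun x => (a.1 x).map_smul _ _ }
  map_one' := rfl
  map_mul' _ _ := rfl
  map_zero' := rfl
  map_add' _ _ := rfl
  commutes' _ := rfl


/-! ### `Γ(End E)` is the algebra of `C^∞(M)`-linear endomorphisms of `Γ(E)` -/

lemma smooth_bump_mul {φ g : M → ℂ} {U V : Set M} (hU : IsOpen U) (hV : IsOpen V)
    (hφ : ContMDiff (𝓡 m) 𝓘(ℝ, ℂ) ∞ φ) (hφU : tsupport φ ⊆ U)
    (hg : ContMDiffOn (𝓡 m) 𝓘(ℝ, ℂ) ∞ g (U ∩ V)) :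
    ContMDiffOn (𝓡 m) 𝓘(ℝ, ℂ) ∞ (fun x => φ x * g x) V := by
  intro x hxV
  refine ContMDiffAt.contMDiffWithinAt ?_
  by_cases hx : x ∈ U
  · exact (hφ x).mul (hg.contMDiffAt ((hU.inter hV).mem_nhds ⟨hx, hxV⟩))
  · have h0 : φ =ᶠ[nhds x] 0 := notMem_tsupport_iff_eventuallyEq.1 fun h => hx (hφU h)
    refine (contMDiffAt_const (c := (0 : ℂ))).congr_of_eventuallyEq ?_
    filter_upwards [h0] with y hy
    rw [hy, Pi.zero_apply, zero_mul]

lemma sum_smul_apply (f : Fin n → SmoothFun m M) (s : Fin n → Sections m n E) (x : M) :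
    (∑ j, f j • s j).1 x = ∑ j, f j x • (s j).1 x := by
  let ev : Sections m n E →+ E x :=
    { toFun := fun s => s.1 x, map_zero' := rfl, map_add' := fun _ _ => rfl }
  exact map_sum ev _ _

lemma sum_smul_frame (e : Trivialization (Fin n → ℂ) (π (Fin n → ℂ) E))
    [MemTrivializationAtlas e] {x : M} (hx : x ∈ e.baseSet) (v : E x) :
    ∑ j, e.linearMapAt ℂ x v j • e.symmₗ ℂ x (Pi.single j 1) = v := by
  simp only [← map_smul, ← map_sum]
  rw [← pi_eq_sum_univ' (e.linearMapAt ℂ x v), Trivialization.symmₗ_linearMapAt _ hx]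

variable [IsManifold (𝓡 m) ∞ M] [T2Space M]

lemma exists_bump {x₀ : M} {U : Set M} (hU : U ∈ nhds x₀) :
    ∃ φ : SmoothFun m M, tsupport (φ : M → ℂ) ⊆ U ∧ ∀ᶠ x in nhds x₀, φ x = 1 := by
  obtain ⟨f, hf, -⟩ :=
    (SmoothBumpFunction.nhds_basis_support (I := 𝓡 m) hU).mem_iff.1 hU
  refine ⟨⟨fun x => (f x : ℂ), ?_⟩, ?_, ?_⟩
  · exact (Complex.ofRealCLM.contDiff (n := ∞)).contMDiff.comp f.contMDiff
  · refine subset_trans (closure_mono fun x hx => ?_) hf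
    simpa using hx
  · filter_upwards [f.eventuallyEq_one] with x hx
    simp [hx]

/-- Smooth global sections restricting near a point to the frame of a trivialization. -/
lemma exists_frame [SUStructure m n E] (e : Trivialization (Fin n → ℂ) (π (Fin n → ℂ) E))
    [MemTrivializationAtlas e] {x₀ : M} (hx₀ : x₀ ∈ e.baseSet) :
    ∃ s : Fin n → Sections m n E, ∀ᶠ x in nhds x₀, x ∈ e.baseSet ∧
      ∀ j, (s j).1 x = e.symmₗ ℂ x (Pi.single j 1) := by
  obtain ⟨φ, hφ, hφ1⟩ := exists_bump (m := m) (e.open_baseSet.mem_nhds hx₀)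
  refine ⟨fun j => ⟨fun x => φ x • e.symmₗ ℂ x (Pi.single j 1), fun e' _ i => ?_⟩, ?_⟩
  · refine (smooth_bump_mul e.open_baseSet e'.open_baseSet φ.2 hφ
      (SUStructure.smooth e e' i j)).congr fun x _ => ?_
    rw [map_smul, transition, LinearMap.toMatrix'_apply]
    rfl
  · filter_upwards [hφ1, e.open_baseSet.mem_nhds hx₀] with x hx hxe
    exact ⟨hxe, fun j => by simp only [hx, one_smul]⟩

lemma exists_section [SUStructure m n E] (x : M) (v : E x) : ∃ s : Sections m n E, s.1 x = v := by
  have hx := FiberBundle.mem_baseSet_trivializationAt' (F := Fin n → ℂ) (E := E) x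
  obtain ⟨s, hs⟩ := exists_frame (m := m) (trivializationAt (Fin n → ℂ) E x) hx
  obtain ⟨-, hs⟩ := hs.self_of_nhds
  refine ⟨∑ j, (algebraMap ℂ (SmoothFun m M)
    ((trivializationAt (Fin n → ℂ) E x).linearMapAt ℂ x v j)) • s j, ?_⟩
  rw [sum_smul_apply]
  conv_rhs => rw [← sum_smul_frame (trivializationAt (Fin n → ℂ) E x) hx v]
  exact Finset.sum_congr rfl fun j _ => by rw [hs j]; rfl

/-- `C^∞(M)`-linear endomorphisms of `Γ(E)` are tensorial. -/
lemma tensorial [SUStructure m n E] (K : Module.End (SmoothFun m M) (Sections m n E))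
    (s : Sections m n E) (y : M) (hs : s.1 y = 0) : (K s).1 y = 0 := by
  have hy := FiberBundle.mem_baseSet_trivializationAt' (F := Fin n → ℂ) (E := E) y
  set e := trivializationAt (Fin n → ℂ) E y with he
  obtain ⟨t, ht⟩ := exists_frame (m := m) e hy
  obtain ⟨W, hW, hWo, hyW⟩ := eventually_nhds_iff.1 ht
  obtain ⟨φ, hφ, hφ1⟩ := exists_bump (m := m) (hWo.mem_nhds hyW)
  have hφy : φ y = 1 := hφ1.self_of_nhds
  have hφ0 : ∀ x, x ∉ W → φ x = 0 := fun x hx =>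
    image_eq_zero_of_notMem_tsupport fun h => hx (hφ h)
  let f : Fin n → SmoothFun m M := fun j =>
    ⟨fun x => φ x * e.linearMapAt ℂ x (s.1 x) j, contMDiffOn_univ.1
      (smooth_bump_mul hWo isOpen_univ φ.2 hφ ((s.2 e j).mono fun x hx => (hW x hx.1).1))⟩
  have key : φ • s = ∑ j, f j • t j := by
    refine Subtype.ext (funext fun x => ?_)
    rw [sum_smul_apply]
    change φ x • s.1 x = ∑ j, (φ x * e.linearMapAt ℂ x (s.1 x) j) • (t j).1 x
    by_cases hx : x ∈ W
    · simp only [mul_smul, ← Finset.smul_sum, (hW x hx).2]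
      rw [sum_smul_frame e (hW x hx).1]
    · simp [hφ0 x hx]
  have h1 : (φ • K s).1 y = (∑ j, f j • K (t j)).1 y := by
    rw [← map_smul, key, map_sum]
    simp only [map_smul]
  rw [sum_smul_apply] at h1
  change φ y • (K s).1 y = _ at h1
  rw [hφy, one_smul] at h1
  rw [h1]
  refine Finset.sum_eq_zero fun j _ => ?_
  change (φ y * e.linearMapAt ℂ y (s.1 y) j) • (K (t j)).1 y = 0
  rw [hs, map_zero, Pi.zero_apply, mul_zero, zero_smul]

theorem toEnd_bijective [SUStructure m n E] :
    Function.Bijective (toEnd : EndAlg m n E →ₐ[SmoothFun m M] _) := by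
  constructor
  · intro a b hab
    refine Subtype.ext (funext fun x => LinearMap.ext fun v => ?_)
    obtain ⟨s, rfl⟩ := exists_section (m := m) (n := n) x v
    exact congrFun (congrArg Subtype.val (LinearMap.congr_fun hab s)) x
  · intro K
    choose σ hσ using fun x (v : E x) => exists_section (m := m) (n := n) x v
    have hK : ∀ (x : M) (s t : Sections m n E), s.1 x = t.1 x → (K s).1 x = (K t).1 x := by
      intro x s t hst
      have h := tensorial K (s - t) x (sub_eq_zero.2 hst)
      rw [map_sub] at h
      exact sub_eq_zero.1 h
    let a : ∀ x, Module.End ℂ (E x) := fun x =>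
      { toFun := fun v => (K (σ x v)).1 x
        map_add' := fun v w => by
          rw [hK x (σ x (v + w)) (σ x v + σ x w), map_add]
          · rfl
          · rw [hσ]
            change _ = (σ x v).1 x + (σ x w).1 x
            rw [hσ, hσ]
        map_smul' := fun c v => by
          rw [hK x (σ x (c • v)) (algebraMap ℂ (SmoothFun m M) c • σ x v), map_smul]
          · rfl
          · rw [hσ]
            change _ = c • (σ x v).1 x
            rw [hσ] }
    have haK : ∀ x (s : Sections m n E), a x (s.1 x) = (K s).1 x := fun x s => hK x _ _ (hσ _ _)
    refine ⟨⟨a, fun e _ i j x hx => ContMDiffAt.contMDiffWithinAt ?_⟩,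
      LinearMap.ext fun s => Subtype.ext (funext fun x => haK x s)⟩
    obtain ⟨t, ht⟩ := exists_frame (m := m) e hx
    refine (((K (t j)).2 e i).contMDiffAt (e.open_baseSet.mem_nhds hx)).congr_of_eventuallyEq ?_
    filter_upwards [ht] with y hy
    rw [endMatrix, LinearMap.toMatrix'_apply, LinearMap.comp_apply, LinearMap.comp_apply,
      ← hy.2 j, haK]

/-- The canonical isomorphism `Γ(End E) ≅ End_{C^∞(M)}(Γ(E))`. -/
noncomputable def endEquiv [SUStructure m n E] :
    EndAlg m n E ≃ₐ[SmoothFun m M] Module.End (SmoothFun m M) (Sections m n E) :=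
  AlgEquiv.ofBijective toEnd toEnd_bijective

lemma toEnd_endEquiv_symm [SUStructure m n E]
    (K : Module.End (SmoothFun m M) (Sections m n E)) (s : Sections m n E) :
    toEnd (endEquiv.symm K) s = K s :=
  LinearMap.congr_fun (endEquiv.apply_symm_apply K) s

lemma eq_of_toEnd [SUStructure m n E] {a b : EndAlg m n E}
    (h : ∀ s : Sections m n E, toEnd a s = toEnd b s) : a = b :=
  toEnd_bijective.1 (LinearMap.ext h)

end Bundles

/-! ### Derivations of `A = Γ(End E)` -/

section Derivations

variable {m : ℕ} {M : Type*} [TopologicalSpace M] [ChartedSpace (EuclideanSpace ℝ (Fin m)) M]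
  {n : ℕ} {E : M → Type*}
  [∀ x, AddCommGroup (E x)] [∀ x, Module ℂ (E x)] [∀ x, TopologicalSpace (E x)]
  [TopologicalSpace (TotalSpace (Fin n → ℂ) E)] [FiberBundle (Fin n → ℂ) E]
  [VectorBundle ℂ (Fin n → ℂ) E]

variable (m n E) in
/-- The derivations among all `ℂ`-linear maps `A → A`. -/
def derivations : Submodule (SmoothFun m M) (EndAlg m n E →ₗ[ℂ] EndAlg m n E) where
  carrier := {D | ∀ a b, D (a * b) = D a * b + a * D b}
  add_mem' {D D'} hD hD' a b := by
    rw [LinearMap.add_apply, LinearMap.add_apply, LinearMap.add_apply, hD a b, hD' a b, add_mul,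
      mul_add]
    abel
  zero_mem' a b := by simp
  smul_mem' f D hD a b := by
    rw [LinearMap.smul_apply, LinearMap.smul_apply, LinearMap.smul_apply, hD a b, smul_add,
      smul_mul_assoc, mul_smul_comm]

variable (m n E) in
/-- The `C^∞(M)`-module `Der(A)` of `ℂ`-linear derivations of `A = Γ(End E)`. -/
def Der : Type _ := derivations m n E

instance : AddCommGroup (Der m n E) := inferInstanceAs (AddCommGroup (derivations m n E))
instance : Module (SmoothFun m M) (Der m n E) :=
  inferInstanceAs (Module (SmoothFun m M) (derivations m n E))
instance : CoeFun (Der m n E) fun _ => EndAlg m n E → EndAlg m n E := ⟨fun D => D.1⟩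

variable (m n E) in
/-- The trace-free sections among all sections of `End E`. -/
def traceFree : Submodule (SmoothFun m M) (EndAlg m n E) where
  carrier := {a | ∀ x, LinearMap.trace ℂ (E x) (a x) = 0}
  add_mem' {a b} ha hb x := by
    change LinearMap.trace ℂ (E x) (a x + b x) = 0
    rw [map_add, ha x, hb x, add_zero]
  zero_mem' x := map_zero _
  smul_mem' f a ha x := by
    change LinearMap.trace ℂ (E x) (f x • a x) = 0
    rw [map_smul, ha x, smul_zero]

variable (m n E) in
/-- The `C^∞(M)`-module `A₀` of trace-free elements of `A = Γ(End E)`. -/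
def EndAlg₀ : Type _ := traceFree m n E

instance : AddCommGroup (EndAlg₀ m n E) := inferInstanceAs (AddCommGroup (traceFree m n E))
instance : Module (SmoothFun m M) (EndAlg₀ m n E) :=
  inferInstanceAs (Module (SmoothFun m M) (traceFree m n E))
instance : CoeFun (EndAlg₀ m n E) fun _ => ∀ x, Module.End ℂ (E x) := ⟨fun a => a.1⟩

/-- The inner derivation `ad_γ : a ↦ γ a - a γ`, for `γ ∈ A`. -/
def ad : EndAlg m n E →ₗ[SmoothFun m M] Der m n E where
  toFun γ :=
    ⟨{ toFun := fun a => γ * a - a * γ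
       map_add' := fun a b => by rw [mul_add, add_mul]; abel
       map_smul' := fun c a => by
        rw [RingHom.id_apply, mul_smul_comm, smul_mul_assoc, smul_sub] },
      fun a b => by
        change γ * (a * b) - a * b * γ = (γ * a - a * γ) * b + a * (γ * b - b * γ)
        noncomm_ring⟩
  map_add' γ δ := Subtype.ext <| LinearMap.ext fun a => by
    change (γ + δ) * a - a * (γ + δ) = (γ * a - a * γ) + (δ * a - a * δ)
    noncomm_ring
  map_smul' f γ := Subtype.ext <| LinearMap.ext fun a => by
    change (f • γ) * a - a * (f • γ) = f • (γ * a - a * γ)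
    rw [smul_mul_assoc, mul_smul_comm, smul_sub]

/-- The restriction of `ad` to `A₀`. -/
def ad₀ : EndAlg₀ m n E →ₗ[SmoothFun m M] Der m n E :=
  ad.comp (traceFree m n E).subtype

/-- The fibrewise trace `A → C^∞(M)`. -/
noncomputable def trace : EndAlg m n E →ₗ[SmoothFun m M] SmoothFun m M where
  toFun a := ⟨fun x => LinearMap.trace ℂ (E x) (a x), fun x => by
    have hx := FiberBundle.mem_baseSet_trivializationAt' (F := Fin n → ℂ) (E := E) x
    refine ((contMDiffOn_finsetSum (t := Finset.univ) fun i _ =>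
      a.2 (trivializationAt (Fin n → ℂ) E x) i i).congr fun y hy => ?_).contMDiffAt
        ((trivializationAt (Fin n → ℂ) E x).open_baseSet.mem_nhds hx)
    rw [trace_eq_endMatrix _ hy]
    rfl⟩
  map_add' a b := Subtype.ext <| funext fun x => map_add (LinearMap.trace ℂ (E x)) _ _
  map_smul' f a := Subtype.ext <| funext fun x => map_smul (LinearMap.trace ℂ (E x)) _ _

/-- `ρ : Der(A) → Der(C^∞(M)) = Γ(TM)`, the restriction of a derivation of `A` to the centre
`C^∞(M) · 1` of `A`: since `𝒳(f · 1)` is a central element `g · 1`, the function `g` is its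
normalized trace (see `rho_spec`). -/
noncomputable def rho : Der m n E →ₗ[SmoothFun m M] VectorField m M where
  toFun 𝒳 := Derivation.mk'
    { toFun := fun f => (n : ℂ)⁻¹ • trace (𝒳 (f • (1 : EndAlg m n E)))
      map_add' := fun f g => by
        rw [add_smul, 𝒳.1.map_add, map_add, smul_add]
      map_smul' := fun c f => by
        rw [smul_assoc, 𝒳.1.map_smul, RingHom.id_apply, smul_comm c]
        congr 1
        exact LinearMap.map_smul_of_tower trace c _ }
    fun f g => by
      have h : (f * g) • (1 : EndAlg m n E) = (f • 1) * (g • 1) := by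
        rw [smul_mul_smul_comm, one_mul]
      change (n : ℂ)⁻¹ • trace (𝒳 ((f * g) • (1 : EndAlg m n E))) =
        f • (n : ℂ)⁻¹ • trace (𝒳 (g • (1 : EndAlg m n E))) +
        g • (n : ℂ)⁻¹ • trace (𝒳 (f • (1 : EndAlg m n E)))
      rw [h, 𝒳.2, map_add, mul_smul_comm, mul_one, smul_mul_assoc, one_mul, trace.map_smul,
        trace.map_smul, smul_add, add_comm, smul_comm f, smul_comm g]
  map_add' 𝒳 𝒴 := Derivation.ext fun f => by
    change (n : ℂ)⁻¹ • trace (𝒳 (f • (1 : EndAlg m n E)) + 𝒴 (f • (1 : EndAlg m n E))) =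
      (n : ℂ)⁻¹ • trace (𝒳 (f • (1 : EndAlg m n E))) +
      (n : ℂ)⁻¹ • trace (𝒴 (f • (1 : EndAlg m n E)))
    rw [map_add, smul_add]
  map_smul' g 𝒳 := Derivation.ext fun f => by
    change (n : ℂ)⁻¹ • trace (g • 𝒳 (f • (1 : EndAlg m n E))) =
      g • (n : ℂ)⁻¹ • trace (𝒳 (f • (1 : EndAlg m n E)))
    rw [map_smul, smul_comm g]

lemma exists_end [IsManifold (𝓡 m) ∞ M] [T2Space M] [SUStructure m n E] (x : M)
    (T : Module.End ℂ (E x)) : ∃ b : EndAlg m n E, b x = T := by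
  have hx := FiberBundle.mem_baseSet_trivializationAt' (F := Fin n → ℂ) (E := E) x
  set e := trivializationAt (Fin n → ℂ) E x with he
  obtain ⟨φ, hφ, hφ1⟩ := exists_bump (m := m) (e.open_baseSet.mem_nhds hx)
  refine ⟨⟨fun y => φ y • (e.symmₗ ℂ y ∘ₗ Matrix.toLin' (endMatrix e x T) ∘ₗ e.linearMapAt ℂ y),
    fun e' _ i j => ?_⟩, ?_⟩
  · have h1 : ∀ k l, ContMDiffOn (𝓡 m) 𝓘(ℝ, ℂ) ∞
        (fun y => transition e e' y i k * endMatrix e x T k l * transition e' e y l j)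
        (e.baseSet ∩ e'.baseSet) := fun k l =>
      ((SUStructure.smooth e e' i k).mul contMDiffOn_const).mul
        ((SUStructure.smooth e' e l j).mono fun y hy => ⟨hy.2, hy.1⟩)
    refine (smooth_bump_mul e.open_baseSet e'.open_baseSet φ.2 hφ
      (contMDiffOn_finsetSum (t := Finset.univ) fun l _ =>
        contMDiffOn_finsetSum (t := Finset.univ) fun k _ => h1 k l)).congr fun y _ => ?_
    have h2 : endMatrix e' y
        (φ y • (e.symmₗ ℂ y ∘ₗ Matrix.toLin' (endMatrix e x T) ∘ₗ e.linearMapAt ℂ y)) =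
        φ y • (transition e e' y * endMatrix e x T * transition e' e y) := by
      conv_rhs => rw [transition, transition, ← LinearMap.toMatrix'_toLin' (endMatrix e x T),
        ← LinearMap.toMatrix'_comp, ← LinearMap.toMatrix'_comp, ← map_smul]
      rw [endMatrix]
      congr 1
      refine LinearMap.ext fun v => ?_
      simp only [LinearMap.comp_apply, LinearMap.smul_apply, map_smul]
    rw [h2, Matrix.smul_apply, Matrix.mul_apply]
    simp only [Matrix.mul_apply, Finset.sum_mul]
    rfl
  · refine LinearMap.ext fun v => ?_
    change φ x • e.symmₗ ℂ x (Matrix.toLin' (endMatrix e x T) (e.linearMapAt ℂ x v)) = T v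
    rw [hφ1.self_of_nhds, one_smul, endMatrix, Matrix.toLin'_toMatrix', LinearMap.comp_apply,
      LinearMap.comp_apply, Trivialization.symmₗ_linearMapAt _ hx,
      Trivialization.symmₗ_linearMapAt _ hx]

/-- `ρ(𝒳)` is the restriction of `𝒳` to the centre `C^∞(M) · 1` of `A`. -/
theorem rho_spec [IsManifold (𝓡 m) ∞ M] [T2Space M] [SUStructure m n E] [NeZero n]
    (𝒳 : Der m n E) (f : SmoothFun m M) :
    𝒳 (f • (1 : EndAlg m n E)) = rho 𝒳 f • (1 : EndAlg m n E) := by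
  have hc : ∀ b : EndAlg m n E,
      b * 𝒳 (f • (1 : EndAlg m n E)) = 𝒳 (f • (1 : EndAlg m n E)) * b := by
    intro b
    have h1 := 𝒳.2 (f • (1 : EndAlg m n E)) b
    have h2 := 𝒳.2 b (f • (1 : EndAlg m n E))
    have h3 : f • (1 : EndAlg m n E) * b = b * f • (1 : EndAlg m n E) := by
      rw [smul_mul_assoc, one_mul, mul_smul_comm, mul_one]
    rw [h3, h2, smul_mul_assoc, one_mul, mul_smul_comm, mul_one, add_comm] at h1
    exact add_right_cancel (h1.trans (add_comm _ _) |>.trans (add_comm _ _))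
  refine Subtype.ext (funext fun x => ?_)
  have hx := FiberBundle.mem_baseSet_trivializationAt' (F := Fin n → ℂ) (E := E) x
  obtain ⟨c, hcx⟩ : ∃ c : ℂ, algebraMap ℂ (Module.End ℂ (E x)) c =
      𝒳 (f • (1 : EndAlg m n E)) x := by
    have h : 𝒳 (f • (1 : EndAlg m n E)) x ∈ Subalgebra.center ℂ (Module.End ℂ (E x)) := by
      rw [Subalgebra.mem_center_iff]
      intro T
      obtain ⟨b, rfl⟩ := exists_end (m := m) (n := n) x T
      exact congrFun (congrArg Subtype.val (hc b)) x
    exact Algebra.mem_bot.1 (Algebra.IsCentral.out h)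
  have ht : LinearMap.trace ℂ (E x) (𝒳 (f • (1 : EndAlg m n E)) x) = c * n := by
    rw [← hcx, trace_eq_endMatrix _ hx, endMatrix_smul_one _ hx, Matrix.trace_smul,
      Matrix.trace_one, Fintype.card_fin, smul_eq_mul]
  change 𝒳 (f • (1 : EndAlg m n E)) x =
    ((n : ℂ)⁻¹ * LinearMap.trace ℂ (E x) (𝒳 (f • (1 : EndAlg m n E)) x)) • 1
  rw [ht, ← hcx, mul_comm c, inv_mul_cancel_left₀ (Nat.cast_ne_zero.2 (NeZero.ne n)),
    Algebra.algebraMap_eq_smul_one]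

end Derivations

/-! ### Connections -/

section Connections

variable (m : ℕ) {M : Type*} [TopologicalSpace M] [ChartedSpace (EuclideanSpace ℝ (Fin m)) M]
  (n : ℕ) (E : M → Type*)
  [∀ x, AddCommGroup (E x)] [∀ x, Module ℂ (E x)] [∀ x, TopologicalSpace (E x)]
  [TopologicalSpace (TotalSpace (Fin n → ℂ) E)] [FiberBundle (Fin n → ℂ) E]
  [VectorBundle ℂ (Fin n → ℂ) E]

/-- A (Koszul, complex linear) connection `∇` on the vector bundle `E`. -/
@[ext]
structure Connection where
  /-- The covariant derivative `X ↦ s ↦ ∇_X s`. -/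
  cov : VectorField m M →ₗ[SmoothFun m M] (Sections m n E →ₗ[ℂ] Sections m n E)
  leibniz : ∀ (X : VectorField m M) (f : SmoothFun m M) (s : Sections m n E),
    cov X (f • s) = X f • s + f • cov X s

variable {m n E}

/-- The operator `s ↦ ∇_X (a s) - a (∇_X s)`, which is `C^∞(M)`-linear. -/
def Connection.commutator (D : Connection m n E) (X : VectorField m M) (a : EndAlg m n E) :
    Module.End (SmoothFun m M) (Sections m n E) where
  toFun s := D.cov X (toEnd a s) - toEnd a (D.cov X s)
  map_add' s t := by
    rw [map_add, map_add, map_add, map_add]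
    abel
  map_smul' f s := by
    rw [map_smul, D.leibniz, D.leibniz, map_add, map_smul, map_smul, RingHom.id_apply, smul_sub]
    abel

lemma Connection.commutator_apply (D : Connection m n E) (X : VectorField m M)
    (a : EndAlg m n E) (s : Sections m n E) :
    D.commutator X a s = D.cov X (toEnd a s) - toEnd a (D.cov X s) := rfl

section

variable [IsManifold (𝓡 m) ∞ M] [T2Space M] [SUStructure m n E]

/-- The volume `vol(s₁, …, s_n) ∈ C^∞(M)` of `n` sections of `E`. -/
noncomputable def vol (s : Fin n → Sections m n E) : SmoothFun m M :=
  ⟨fun x => volAt x fun j => s j x, fun x => by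
    have hx := FiberBundle.mem_baseSet_trivializationAt' (F := Fin n → ℂ) (E := E) x
    refine (ContMDiffOn.congr (f := fun y => (Matrix.of fun i j =>
      (trivializationAt (Fin n → ℂ) E x).linearMapAt ℂ y (s j y) i).det) ?_
        fun y hy => volAt_eq (m := m) _ hy _).contMDiffAt
          ((trivializationAt (Fin n → ℂ) E x).open_baseSet.mem_nhds hx)
    simp only [Matrix.det_apply', Matrix.of_apply]
    exact contMDiffOn_finsetSum fun σ _ => contMDiffOn_const.mul
      (contMDiffOn_finsetProd fun i _ => (s i).2 (trivializationAt (Fin n → ℂ) E x) (σ i))⟩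

/-- The hermitian product `⟨s, t⟩ ∈ C^∞(M)` of two sections of `E`. -/
noncomputable def herm (s t : Sections m n E) : SmoothFun m M :=
  ⟨fun x => hermAt n x (s x) (t x), fun x => by
    have hx := FiberBundle.mem_baseSet_trivializationAt' (F := Fin n → ℂ) (E := E) x
    refine (ContMDiffOn.congr (f := fun y =>
      star ((trivializationAt (Fin n → ℂ) E x).linearMapAt ℂ y (s y)) ⬝ᵥ
        (trivializationAt (Fin n → ℂ) E x).linearMapAt ℂ y (t y)) ?_
        fun y hy => hermAt_eq (m := m) _ hy _ _).contMDiffAt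
          ((trivializationAt (Fin n → ℂ) E x).open_baseSet.mem_nhds hx)
    refine contMDiffOn_finsetSum (t := Finset.univ) fun i _ => ContMDiffOn.mul ?_
      (t.2 (trivializationAt (Fin n → ℂ) E x) i)
    exact (Complex.conjCLE.contDiff (n := ∞)).contMDiff.comp_contMDiffOn
      (s.2 (trivializationAt (Fin n → ℂ) E x) i)⟩

/-- The connection preserves the volume form of `E`, that is, its local connection forms have
values in `sl(n, ℂ)`. -/
def Connection.IsSpecial (D : Connection m n E) : Prop :=
  ∀ (X : VectorField m M) (s : Fin n → Sections m n E),
    X (vol s) = ∑ k, vol (Function.update s k (D.cov X (s k)))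

/-- The connection preserves the hermitian structure of `E`. -/
def Connection.IsHermitian (D : Connection m n E) : Prop :=
  ∀ X : VectorField m M, IsRealField X → ∀ s t : Sections m n E,
    X (herm s t) = herm (D.cov X s) t + herm s (D.cov X t)

/-- The connection induced by `∇` on `End E`, as the map `X ↦ ∇_X ∈ Der(A)`: for `a ∈ A`, the
section `∇_X a ∈ A` is determined by `(∇_X a) s = ∇_X (a s) - a (∇_X s)` for all `s ∈ Γ(E)`. -/
noncomputable def Connection.onEnd (D : Connection m n E) :
    VectorField m M →ₗ[SmoothFun m M] Der m n E where
  toFun X :=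
    ⟨{ toFun := fun a => endEquiv.symm (D.commutator X a)
       map_add' := fun a b => eq_of_toEnd fun s => by
        rw [map_add toEnd, LinearMap.add_apply]
        simp only [toEnd_endEquiv_symm, D.commutator_apply, map_add toEnd, LinearMap.add_apply,
          map_add (D.cov X)]
        abel
       map_smul' := fun c a => eq_of_toEnd fun s => by
        have h : ∀ (b : EndAlg m n E) (t : Sections m n E), toEnd (c • b) t = c • toEnd b t :=
          fun _ _ => rfl
        rw [RingHom.id_apply, h]
        simp only [toEnd_endEquiv_symm, D.commutator_apply, h, map_smul (D.cov X), smul_sub] },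
      fun a b => eq_of_toEnd fun s => by
        change toEnd (endEquiv.symm (D.commutator X (a * b))) s =
          toEnd (endEquiv.symm (D.commutator X a) * b + a * endEquiv.symm (D.commutator X b)) s
        simp only [map_add toEnd, map_mul toEnd, LinearMap.add_apply, Module.End.mul_apply,
          toEnd_endEquiv_symm, D.commutator_apply, map_sub (toEnd a)]
        abel⟩
  map_add' X Y := Subtype.ext <| LinearMap.ext fun a => eq_of_toEnd fun s => by
    change toEnd (endEquiv.symm (D.commutator (X + Y) a)) s =
      toEnd (endEquiv.symm (D.commutator X a) + endEquiv.symm (D.commutator Y a)) s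
    simp only [map_add toEnd, LinearMap.add_apply, toEnd_endEquiv_symm, D.commutator_apply,
      map_add D.cov, map_add (toEnd a)]
    abel
  map_smul' f X := Subtype.ext <| LinearMap.ext fun a => eq_of_toEnd fun s => by
    change toEnd (endEquiv.symm (D.commutator (f • X) a)) s =
      toEnd (f • endEquiv.symm (D.commutator X a)) s
    simp only [map_smul toEnd, LinearMap.smul_apply, toEnd_endEquiv_symm, D.commutator_apply,
      map_smul D.cov, map_smul (toEnd a), smul_sub]

/-- Defining property of the induced connection. -/
theorem Connection.onEnd_spec (D : Connection m n E) (X : VectorField m M) (a : EndAlg m n E)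
    (s : Sections m n E) :
    applySection (D.onEnd X a) s = D.cov X (applySection a s) - applySection a (D.cov X s) :=
  toEnd_endEquiv_symm (D.commutator X a) s

end

/-- `α` is the noncommutative `1`-form of the connection `∇`: `α(𝒳) ∈ A₀` is characterized by the
decomposition `𝒳 = ∇_{ρ(𝒳)} - ad_{α(𝒳)}`. -/
def IsConnectionForm [IsManifold (𝓡 m) ∞ M] [T2Space M] [SUStructure m n E]
    (D : Connection m n E) (α : Der m n E →ₗ[SmoothFun m M] EndAlg₀ m n E) : Prop :=
  ∀ 𝒳 : Der m n E, 𝒳 = D.onEnd (rho 𝒳) - ad₀ (α 𝒳)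

end Connections

/-! ### Metrics on `Der(A)`, on `M`, and inner metrics -/

section Metrics

variable {m : ℕ} {M : Type*} [TopologicalSpace M] [ChartedSpace (EuclideanSpace ℝ (Fin m)) M]
  {n : ℕ} {E : M → Type*}
  [∀ x, AddCommGroup (E x)] [∀ x, Module ℂ (E x)] [∀ x, TopologicalSpace (E x)]
  [TopologicalSpace (TotalSpace (Fin n → ℂ) E)] [FiberBundle (Fin n → ℂ) E]
  [VectorBundle ℂ (Fin n → ℂ) E]

/-- Nondegeneracy, at every point `x` of `M`, of a form on `A₀`: in a local frame of trace-free
endomorphisms, the matrix of the form is invertible at `x`. -/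
def IsNondegenerateInner (μ : LinearMap.BilinForm (SmoothFun m M) (EndAlg₀ m n E)) : Prop :=
  ∀ (x : M) (γ : EndAlg₀ m n E), (∀ η, μ γ η x = 0) → γ x = 0

/-- Nondegeneracy, at every point `x` of `M`, of a form on `Der(A)`. The value at `x` of a
derivation `𝒳` is the map `a ↦ (𝒳 a)(x)`. -/
def IsNondegenerateDer (h : LinearMap.BilinForm (SmoothFun m M) (Der m n E)) : Prop :=
  ∀ (x : M) (𝒳 : Der m n E), (∀ 𝒴, h 𝒳 𝒴 x = 0) → ∀ a, 𝒳 a x = 0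

/-- Nondegeneracy, at every point `x` of `M`, of a form on `Γ(TM)`. The value at `x` of a vector
field `X` is the map `f ↦ (X f)(x)`. -/
def IsNondegenerateField (g : LinearMap.BilinForm (SmoothFun m M) (VectorField m M)) : Prop :=
  ∀ (x : M) (X : VectorField m M), (∀ Y, g X Y x = 0) → ∀ f, X f x = 0

/-- A real derivation of `A`, that is, `𝒳(a*) = 𝒳(a)*`: it maps pairs of adjoint sections of
`End E` (for the hermitian structure of `E`) to pairs of adjoint sections. -/
def IsRealDer (𝒳 : Der m n E) : Prop :=
  ∀ a b : EndAlg m n E,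
    (∀ (x : M) (v w : E x), hermAt n x (a x v) w = hermAt n x v (b x w)) →
    ∀ (x : M) (v w : E x), hermAt n x (𝒳 a x v) w = hermAt n x v (𝒳 b x w)

/-- A real form on `Der(A)`: it takes real values on real derivations. -/
def IsRealForm (h : LinearMap.BilinForm (SmoothFun m M) (Der m n E)) : Prop :=
  ∀ 𝒳 𝒴 : Der m n E, IsRealDer 𝒳 → IsRealDer 𝒴 → IsRealFun (h 𝒳 𝒴)

/-- `h(∇_X, ad_γ) = 0` for all vector fields `X` and all `γ ∈ A`. -/
def IsOrthogonal [IsManifold (𝓡 m) ∞ M] [T2Space M] [SUStructure m n E]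
    (h : LinearMap.BilinForm (SmoothFun m M) (Der m n E)) (D : Connection m n E) : Prop :=
  ∀ (X : VectorField m M) (γ : EndAlg m n E), h (D.onEnd X) (ad γ) = 0

end Metrics

end EndBundle

open EndBundle

/-!
The theorem is linear algebra over `C^∞(M)` combined with gluing. Since the objects to be
constructed are unique, local solutions agree where they overlap and define global ones, without a
partition of unity (`exists_glue_sections`, `exists_glue_end`). Locally everything is expressed in
a unitary unimodular frame (`IsFrameAt`), whose hermitian products give coordinates.

*Existence and uniqueness of the connection.* By nondegeneracy, `h_Int` identifies `A₀` with its
`C^∞(M)`-dual (`exists_represents_traceFree`, by Cramer's rule in a local frame). Consider triples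
`(X, D, 𝒟)` of a vector field, a volume-preserving operator `D` on `Γ(E)` with the Leibniz rule
for `X`, and the derivation `𝒟 = [D, ·]`, required to be `h`-orthogonal to the inner derivations.
They form a `C^∞(M)`-module (`orthogonalOps`). If `X = 0`, then `D` is a trace-free endomorphism
`γ` with `h_Int(γ, ·) = 0`, hence zero (`orthogonalOps_eq_zero`). For given `X`, differentiation of
the coefficients in a local frame is such an operator up to orthogonality, and subtracting the
element of `A₀` that represents `h(𝒟, ad ·)` makes it orthogonal; these operators glue
(`exists_orthogonalOp`). So `X ↦ D` is well defined and linear, and it is the connection.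

*Connection form and decomposition.* A derivation of `A` that vanishes on the centre is inner
(`exists_eq_ad₀`), so `Der(A)` is the direct sum of the horizontal derivations `∇_X` and of
`ad(A₀)`. The connection form is minus the vertical component, and the decomposition of `h`, its
uniqueness and the properties of `h^M` express the orthogonality of the two summands.

*Reality.* For a real vector field `X`, the defect `X⟨s, t⟩ - ⟨∇_X s, t⟩ - ⟨s, ∇_X t⟩` is a
sesquilinear form `⟨s, T t⟩` with `T` self-adjoint and trace-free, and `2 ∇_X + ad T` is a real
derivation. If `h` is real and `γ` is skew-adjoint, then `h(ad T, ad γ) = h(2 ∇_X + ad T, ad γ)`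
and `h(ad (iT), ad γ)` are both real, so that they vanish, and `T = 0`
(`Connection.IsSpecial.isHermitian_of_isRealForm`).
-/

set_option linter.unusedSectionVars false

namespace EndBundle

variable {m : ℕ} {M : Type*} [TopologicalSpace M] [ChartedSpace (EuclideanSpace ℝ (Fin m)) M]
  {n : ℕ} {E : M → Type*}
  [∀ x, AddCommGroup (E x)] [∀ x, Module ℂ (E x)] [∀ x, TopologicalSpace (E x)]
  [TopologicalSpace (TotalSpace (Fin n → ℂ) E)] [FiberBundle (Fin n → ℂ) E]
  [VectorBundle ℂ (Fin n → ℂ) E]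

/-! ### Evaluation at a point -/

namespace SmoothFun

theorem ext {f g : SmoothFun m M} (h : ∀ x, f x = g x) : f = g := Subtype.ext (funext h)

/-- Evaluation of smooth functions at a point. -/
def eval (x : M) : SmoothFun m M →+* ℂ where
  toFun f := f x
  map_one' := rfl
  map_mul' _ _ := rfl
  map_zero' := rfl
  map_add' _ _ := rfl

@[simp] lemma eval_apply (x : M) (f : SmoothFun m M) : eval x f = f x := rfl
@[simp] lemma zero_apply (x : M) : (0 : SmoothFun m M) x = 0 := rfl
@[simp] lemma add_apply (f g : SmoothFun m M) (x : M) : (f + g) x = f x + g x := rfl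
@[simp] lemma sub_apply (f g : SmoothFun m M) (x : M) : (f - g) x = f x - g x := rfl
@[simp] lemma neg_apply (f : SmoothFun m M) (x : M) : (-f) x = -f x := rfl
@[simp] lemma mul_apply (f g : SmoothFun m M) (x : M) : (f * g) x = f x * g x := rfl
@[simp] lemma smul_apply (f g : SmoothFun m M) (x : M) : (f • g) x = f x * g x := rfl
@[simp] lemma algebraMap_apply (c : ℂ) (x : M) : (algebraMap ℂ (SmoothFun m M) c) x = c := rfl
@[simp] lemma sum_apply {ι : Type*} (t : Finset ι) (f : ι → SmoothFun m M) (x : M) :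
    (∑ i ∈ t, f i) x = ∑ i ∈ t, f i x := map_sum (eval x) f t

/-- The complex conjugate of a smooth function. -/
def conj (f : SmoothFun m M) : SmoothFun m M :=
  ⟨fun x => star (f x), (Complex.conjCLE.contDiff (n := ∞)).contMDiff.comp f.2⟩

@[simp] lemma conj_apply (f : SmoothFun m M) (x : M) : conj f x = star (f x) := rfl

end SmoothFun

namespace Sections

theorem ext {s t : Sections m n E} (h : ∀ x, s x = t x) : s = t := Subtype.ext (funext h)

/-- Evaluation of sections at a point. -/
def eval (x : M) : Sections m n E →+ E x where
  toFun s := s x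
  map_zero' := rfl
  map_add' _ _ := rfl

@[simp] lemma zero_apply (x : M) : (0 : Sections m n E) x = 0 := rfl
@[simp] lemma add_apply (s t : Sections m n E) (x : M) : (s + t) x = s x + t x := rfl
@[simp] lemma sub_apply (s t : Sections m n E) (x : M) : (s - t) x = s x - t x := rfl
@[simp] lemma smul_apply (f : SmoothFun m M) (s : Sections m n E) (x : M) :
    (f • s) x = f x • s x := rfl
@[simp] lemma sum_apply {ι : Type*} (t : Finset ι) (s : ι → Sections m n E) (x : M) :
    (∑ i ∈ t, s i) x = ∑ i ∈ t, s i x := map_sum (eval x) s t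

end Sections

namespace EndAlg

theorem ext {a b : EndAlg m n E} (h : ∀ x, a x = b x) : a = b := Subtype.ext (funext h)

/-- Evaluation of sections of the endomorphism bundle at a point. -/
def eval (x : M) : EndAlg m n E →+* Module.End ℂ (E x) where
  toFun a := a x
  map_one' := rfl
  map_mul' _ _ := rfl
  map_zero' := rfl
  map_add' _ _ := rfl

@[simp] lemma one_apply (x : M) : (1 : EndAlg m n E) x = 1 := rfl
@[simp] lemma add_apply (a b : EndAlg m n E) (x : M) : (a + b) x = a x + b x := rfl
@[simp] lemma sub_apply (a b : EndAlg m n E) (x : M) : (a - b) x = a x - b x := rfl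
@[simp] lemma mul_apply (a b : EndAlg m n E) (x : M) : (a * b) x = a x * b x := rfl
@[simp] lemma smul_apply (f : SmoothFun m M) (a : EndAlg m n E) (x : M) :
    (f • a) x = f x • a x := rfl
@[simp] lemma sum_apply {ι : Type*} (t : Finset ι) (a : ι → EndAlg m n E) (x : M) :
    (∑ i ∈ t, a i) x = ∑ i ∈ t, a i x := map_sum (eval x) a t

end EndAlg

@[simp] lemma toEnd_apply_apply (a : EndAlg m n E) (s : Sections m n E) (x : M) :
    (toEnd a s) x = a x (s x) := rfl

lemma trace_apply (a : EndAlg m n E) (x : M) : trace a x = LinearMap.trace ℂ (E x) (a x) := rfl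

lemma ad_apply (γ a : EndAlg m n E) : ad γ a = γ * a - a * γ := rfl

namespace Der

theorem ext {𝒳 𝒴 : Der m n E} (h : ∀ a, 𝒳 a = 𝒴 a) : 𝒳 = 𝒴 :=
  Subtype.ext (LinearMap.ext h)

lemma add_apply (𝒳 𝒴 : Der m n E) (a : EndAlg m n E) : (𝒳 + 𝒴) a = 𝒳 a + 𝒴 a := rfl
lemma sub_apply (𝒳 𝒴 : Der m n E) (a : EndAlg m n E) : (𝒳 - 𝒴) a = 𝒳 a - 𝒴 a := rfl
lemma smul_apply (f : SmoothFun m M) (𝒳 : Der m n E) (a : EndAlg m n E) :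
    (f • 𝒳) a = f • 𝒳 a := rfl

end Der

/-! ### Gluing -/

/-- A family of smooth sections `σ x` that agrees near each `x` with its diagonal `y ↦ σ y y`
glues to a smooth section. -/
lemma exists_glue_sections (σ : M → Sections m n E)
    (hσ : ∀ x, ∀ᶠ y in nhds x, σ x y = σ y y) :
    ∃ s : Sections m n E, ∀ x, s x = σ x x := by
  refine ⟨⟨fun x => σ x x, fun e _ i x hx => ContMDiffAt.contMDiffWithinAt ?_⟩, fun x => rfl⟩
  refine (((σ x).2 e i).contMDiffAt (e.open_baseSet.mem_nhds hx)).congr_of_eventuallyEq ?_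
  filter_upwards [hσ x] with y hy
  rw [hy]

/-- The analogue of `exists_glue_sections` for the endomorphism bundle. -/
lemma exists_glue_end (σ : M → EndAlg m n E)
    (hσ : ∀ x, ∀ᶠ y in nhds x, σ x y = σ y y) :
    ∃ a : EndAlg m n E, ∀ x, a x = σ x x := by
  refine ⟨⟨fun x => σ x x, fun e _ i j x hx => ContMDiffAt.contMDiffWithinAt ?_⟩, fun x => rfl⟩
  refine (((σ x).2 e i j).contMDiffAt (e.open_baseSet.mem_nhds hx)).congr_of_eventuallyEq ?_
  filter_upwards [hσ x] with y hy
  rw [hy]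

/-! ### Cut-off functions and locality -/

section Local

variable [IsManifold (𝓡 m) ∞ M] [T2Space M]

/-- A cut-off function at `x`, supported where a property that holds near `x` is satisfied. -/
lemma exists_cutoff {x : M} {P : M → Prop} (hP : ∀ᶠ y in nhds x, P y) :
    ∃ φ : SmoothFun m M, φ x = 1 ∧ (∀ᶠ y in nhds x, φ y = 1) ∧ ∀ y, φ y = 0 ∨ P y := by
  obtain ⟨φ, hφ, hφ1⟩ := exists_bump (m := m) hP
  refine ⟨φ, hφ1.self_of_nhds, hφ1, fun y => or_iff_not_imp_right.2 fun hy => ?_⟩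
  exact image_eq_zero_of_notMem_tsupport fun h => hy (hφ h)

/-- A vector field is a local operator. -/
lemma field_congr (X : VectorField m M) {f g : SmoothFun m M} {x : M}
    (h : ∀ᶠ y in nhds x, f y = g y) : X f x = X g x := by
  obtain ⟨φ, hφx, -, hφ⟩ := exists_cutoff (m := m) h
  have h0 : φ * (f - g) = 0 := SmoothFun.ext fun y => by
    rcases hφ y with hy | hy <;> simp [hy]
  have h1 := congrArg (fun u : SmoothFun m M => u x) (congrArg X h0)
  have hx := h.self_of_nhds
  simpa [hφx, hx, sub_eq_zero] using h1

lemma field_eq_zero_of_const (X : VectorField m M) {f : SmoothFun m M} {x : M} {c : ℂ}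
    (h : ∀ᶠ y in nhds x, f y = c) : X f x = 0 := by
  rw [field_congr X (g := algebraMap ℂ _ c) (by simpa using h), Derivation.map_algebraMap]
  rfl

/-- A function that does not vanish at `x` is invertible near `x`. -/
lemma exists_local_inv {f : SmoothFun m M} {x : M} (hf : f x ≠ 0) :
    ∃ g : SmoothFun m M, ∀ᶠ y in nhds x, g y * f y = 1 := by
  have hc : Continuous (f : M → ℂ) := ContMDiff.continuous f.2
  have hU : IsOpen {y | f y ≠ 0} := isOpen_ne_fun hc continuous_const
  obtain ⟨φ, hφ, hφ1⟩ := exists_bump (m := m) (hU.mem_nhds hf)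
  refine ⟨⟨fun y => φ y * (f y)⁻¹, contMDiffOn_univ.1
    (smooth_bump_mul hU isOpen_univ φ.2 hφ ?_)⟩, ?_⟩
  · intro y hy
    have h1 : ContDiffAt ℝ ∞ (fun z : ℂ => z⁻¹) (f y) := contDiffAt_inv ℝ hy.1
    exact (h1.contMDiffAt.comp y (f.2 y)).contMDiffWithinAt
  · filter_upwards [hφ1, hU.mem_nhds hf] with y hy hy'
    rw [hy, one_mul, inv_mul_cancel₀ hy']

end Local

variable [IsManifold (𝓡 m) ∞ M] [T2Space M] [SUStructure m n E]

/-! ### The hermitian product -/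

lemma herm_apply (s t : Sections m n E) (x : M) : herm s t x = hermAt n x (s x) (t x) := rfl

lemma vol_apply (s : Fin n → Sections m n E) (x : M) : vol s x = volAt x fun j => s j x := rfl

lemma hermAt_add_right (x : M) (u v w : E x) :
    hermAt n x u (v + w) = hermAt n x u v + hermAt n x u w := by
  simp [hermAt]

lemma hermAt_smul_right (x : M) (c : ℂ) (u v : E x) :
    hermAt n x u (c • v) = c * hermAt n x u v := by
  simp [hermAt]

lemma hermAt_sum_smul_right (x : M) (u : E x) {ι : Type*} (t : Finset ι) (c : ι → ℂ)
    (v : ι → E x) : hermAt n x u (∑ i ∈ t, c i • v i) = ∑ i ∈ t, c i * hermAt n x u (v i) := by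
  simp only [hermAt, map_sum, map_smul, dotProduct_sum, dotProduct_smul, smul_eq_mul]

lemma star_hermAt (x : M) (u v : E x) : star (hermAt n x u v) = hermAt n x v u := by
  rw [hermAt, hermAt, Matrix.star_dotProduct, star_star]

/-- The hermitian product with a fixed left entry, a `C^∞(M)`-linear form on `Γ(E)`. -/
noncomputable def hermₗ (s : Sections m n E) : Sections m n E →ₗ[SmoothFun m M] SmoothFun m M where
  toFun t := herm s t
  map_add' _ _ := SmoothFun.ext fun x => hermAt_add_right x _ _ _
  map_smul' _ _ := SmoothFun.ext fun x => hermAt_smul_right x _ _ _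

@[simp] lemma hermₗ_apply (s t : Sections m n E) : hermₗ s t = herm s t := rfl

lemma conj_herm (s t : Sections m n E) : (herm s t).conj = herm t s :=
  SmoothFun.ext fun x => star_hermAt x _ _

lemma star_herm_apply (s t : Sections m n E) (x : M) : star (herm s t x) = herm t s x :=
  star_hermAt x _ _

lemma herm_add_right (s t u : Sections m n E) : herm s (t + u) = herm s t + herm s u :=
  (hermₗ s).map_add t u

lemma herm_sub_right (s t u : Sections m n E) : herm s (t - u) = herm s t - herm s u :=
  (hermₗ s).map_sub t u

lemma herm_smul_right (f : SmoothFun m M) (s t : Sections m n E) :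
    herm s (f • t) = f * herm s t := (hermₗ s).map_smul f t

lemma herm_add_left (s t u : Sections m n E) : herm (s + t) u = herm s u + herm t u :=
  SmoothFun.ext fun x => by
    rw [← star_herm_apply, herm_add_right]
    simp only [SmoothFun.add_apply, star_add, star_herm_apply]

lemma herm_sub_left (s t u : Sections m n E) : herm (s - t) u = herm s u - herm t u :=
  SmoothFun.ext fun x => by
    rw [← star_herm_apply, herm_sub_right]
    simp only [SmoothFun.sub_apply, star_sub, star_herm_apply]

lemma herm_smul_left (f : SmoothFun m M) (s t : Sections m n E) :
    herm (f • s) t = f.conj * herm s t :=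
  SmoothFun.ext fun x => by
    rw [← star_herm_apply, herm_smul_right]
    simp only [SmoothFun.mul_apply, star_mul', star_herm_apply, SmoothFun.conj_apply]

/-! ### Local unitary unimodular frames -/

/-- The sections `e` form, at the point `y`, a unitary unimodular frame: hermitian products with
them are the coordinates, and the volume form and the trace are computed in these coordinates. -/
structure IsFrameAt (e : Fin n → Sections m n E) (y : M) : Prop where
  herm_eq : ∀ i j, herm (e i) (e j) y = if i = j then 1 else 0
  sum_eq : ∀ s : Sections m n E, ∑ j, herm (e j) s y • e j y = s y
  vol_eq : ∀ s, vol s y = (Matrix.of fun i j => herm (e i) (s j) y).det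
  trace_eq : ∀ a : EndAlg m n E, trace a y = ∑ i, herm (e i) (toEnd a (e i)) y

lemma exists_isFrameAt (x : M) :
    ∃ e : Fin n → Sections m n E, ∀ᶠ y in nhds x, IsFrameAt e y := by
  obtain ⟨e, he⟩ := exists_frame (m := m) (trivializationAt (Fin n → ℂ) E x)
    (FiberBundle.mem_baseSet_trivializationAt' (F := Fin n → ℂ) (E := E) x)
  refine ⟨e, he.mono fun y hy => ?_⟩
  obtain ⟨hy, he⟩ := hy
  set τ := trivializationAt (Fin n → ℂ) E x
  -- hermitian products with the frame are the coordinates in the trivialization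
  have hc : ∀ i (s : Sections m n E), herm (e i) s y = τ.linearMapAt ℂ y (s y) i := fun i s => by
    rw [herm_apply, hermAt_eq (m := m) τ hy, he, Trivialization.linearMapAt_symmₗ _ hy]
    simp
  refine ⟨fun i j => ?_, fun s => ?_, fun s => ?_, fun a => ?_⟩
  · rw [hc, he, Trivialization.linearMapAt_symmₗ _ hy, Pi.single_apply]
  · simp only [hc, he]
    exact sum_smul_frame τ hy _
  · rw [vol_apply, volAt_eq (m := m) τ hy]
    simp only [hc]
  · rw [trace_apply, trace_eq_endMatrix τ hy, Matrix.trace]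
    refine Finset.sum_congr rfl fun i _ => ?_
    rw [hc, toEnd_apply_apply, he, Matrix.diag_apply, endMatrix, LinearMap.toMatrix'_apply]
    rfl

lemma IsFrameAt.apply_eq_sum {e : Fin n → Sections m n E} {y : M} (he : IsFrameAt e y)
    (a : EndAlg m n E) (s : Sections m n E) :
    a y (s y) = ∑ j, herm (e j) s y • a y (e j y) := by
  conv_lhs => rw [← he.sum_eq s]
  simp only [map_sum, map_smul]

lemma IsFrameAt.vol_self {e : Fin n → Sections m n E} {y : M} (he : IsFrameAt e y) :
    vol e y = 1 := by
  rw [he.vol_eq]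
  simp only [he.herm_eq]
  exact Matrix.det_one

lemma section_eq_zero_of_herm {s : Sections m n E} {y : M}
    (h : ∀ t : Sections m n E, herm t s y = 0) : s y = 0 := by
  obtain ⟨e, he⟩ := exists_isFrameAt (m := m) (n := n) (E := E) y
  rw [← he.self_of_nhds.sum_eq s]
  simp [h]

lemma section_eq_of_herm {s s' : Sections m n E} {y : M}
    (h : ∀ t : Sections m n E, herm t s y = herm t s' y) : s y = s' y := by
  refine sub_eq_zero.1 (section_eq_zero_of_herm (s := s - s') fun t => ?_)
  rw [herm_sub_right, SmoothFun.sub_apply, h, sub_self]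

/-- Elements of `A` may be compared at a point through their action on sections. -/
lemma end_apply_eq {a b : EndAlg m n E} {y : M}
    (h : ∀ s : Sections m n E, a y (s y) = b y (s y)) : a y = b y := by
  refine LinearMap.ext fun v => ?_
  obtain ⟨s, rfl⟩ := exists_section (m := m) (n := n) y v
  exact h s

/-! ### The volume form as a multilinear form -/

lemma IsFrameAt.vol_update {e : Fin n → Sections m n E} {y : M} (he : IsFrameAt e y)
    (s : Fin n → Sections m n E) (k : Fin n) (t : Sections m n E) :
    vol (Function.update s k t) y =
      ((Matrix.of fun i j => herm (e i) (s j) y).updateCol k fun i => herm (e i) t y).det := by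
  rw [he.vol_eq]
  congr 1
  ext i j
  rw [Matrix.updateCol_apply, Matrix.of_apply, Matrix.of_apply, Function.update_apply]
  split_ifs <;> rfl

lemma vol_update_add (s : Fin n → Sections m n E) (k : Fin n) (t u : Sections m n E) :
    vol (Function.update s k (t + u)) =
      vol (Function.update s k t) + vol (Function.update s k u) := SmoothFun.ext fun y => by
  obtain ⟨e, he⟩ := exists_isFrameAt (m := m) (n := n) (E := E) y
  have he := he.self_of_nhds
  rw [SmoothFun.add_apply, he.vol_update, he.vol_update, he.vol_update, ← Matrix.det_updateCol_add]
  simp only [herm_add_right, SmoothFun.add_apply]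
  rfl

lemma vol_update_smul (s : Fin n → Sections m n E) (k : Fin n) (f : SmoothFun m M)
    (t : Sections m n E) :
    vol (Function.update s k (f • t)) = f * vol (Function.update s k t) :=
  SmoothFun.ext fun y => by
  obtain ⟨e, he⟩ := exists_isFrameAt (m := m) (n := n) (E := E) y
  have he := he.self_of_nhds
  rw [SmoothFun.mul_apply, he.vol_update, he.vol_update, ← Matrix.det_updateCol_smul]
  simp only [herm_smul_right, SmoothFun.mul_apply]
  rfl

lemma vol_update_congr (s : Fin n → Sections m n E) (k : Fin n) {t u : Sections m n E} {y : M}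
    (h : t y = u y) : vol (Function.update s k t) y = vol (Function.update s k u) y := by
  rw [vol_apply, vol_apply]
  congr 1
  funext j
  by_cases hj : j = k
  · subst hj
    simpa using h
  · simp [hj]

/-- The infinitesimal action of an endomorphism on the volume form is multiplication by its
trace. -/
lemma sum_vol_update_toEnd (a : EndAlg m n E) (s : Fin n → Sections m n E) :
    ∑ k, vol (Function.update s k (toEnd a (s k))) = trace a * vol s := SmoothFun.ext fun y => by
  obtain ⟨e, he⟩ := exists_isFrameAt (m := m) (n := n) (E := E) y
  have he := he.self_of_nhds
  set S : Matrix (Fin n) (Fin n) ℂ := Matrix.of fun i j => herm (e i) (s j) y with hS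
  set T : Matrix (Fin n) (Fin n) ℂ := Matrix.of fun i j => herm (e i) (toEnd a (e j)) y with hT
  have h1 : ∀ k, (fun i => herm (e i) (toEnd a (s k)) y) = fun i => (T * S) i k := fun k => by
    funext i
    rw [herm_apply, toEnd_apply_apply, he.apply_eq_sum, hermAt_sum_smul_right, Matrix.mul_apply]
    exact Finset.sum_congr rfl fun j _ => mul_comm _ _
  have h2 : ∀ k, vol (Function.update s k (toEnd a (s k))) y = (S.adjugate * (T * S)) k k :=
    fun k => by
      rw [he.vol_update, h1, ← Matrix.cramer_apply, Matrix.cramer_eq_adjugate_mulVec]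
      rfl
  have h3 : (S.adjugate * (T * S)).trace = T.trace * S.det := by
    rw [Matrix.trace_mul_comm, Matrix.mul_assoc, Matrix.mul_adjugate, Matrix.mul_smul,
      Matrix.mul_one, Matrix.trace_smul, smul_eq_mul, mul_comm]
  rw [SmoothFun.sum_apply, SmoothFun.mul_apply, he.vol_eq s, he.trace_eq]
  simp only [h2]
  exact h3

/-! ### Endomorphisms of rank one -/

/-- The endomorphism `s ↦ ⟨v, s⟩ u` of rank one. -/
noncomputable def ketbra (u v : Sections m n E) : EndAlg m n E :=
  endEquiv.symm ((hermₗ v).smulRight u)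

@[simp] lemma toEnd_ketbra (u v s : Sections m n E) : toEnd (ketbra u v) s = herm v s • u :=
  toEnd_endEquiv_symm _ _

lemma ketbra_apply (u v s : Sections m n E) (y : M) :
    ketbra u v y (s y) = herm v s y • u y := by
  rw [← toEnd_apply_apply, toEnd_ketbra, Sections.smul_apply]

lemma mul_ketbra (a : EndAlg m n E) (u v : Sections m n E) :
    a * ketbra u v = ketbra (toEnd a u) v := eq_of_toEnd fun s => by
  rw [map_mul, Module.End.mul_apply, toEnd_ketbra, toEnd_ketbra, map_smul]

lemma ketbra_add_left (u u' v : Sections m n E) :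
    ketbra (u + u') v = ketbra u v + ketbra u' v := eq_of_toEnd fun s => by
  rw [map_add, LinearMap.add_apply, toEnd_ketbra, toEnd_ketbra, toEnd_ketbra, smul_add]

lemma ketbra_smul_left (f : SmoothFun m M) (u v : Sections m n E) :
    ketbra (f • u) v = f • ketbra u v := eq_of_toEnd fun s => by
  rw [map_smul, LinearMap.smul_apply, toEnd_ketbra, toEnd_ketbra, smul_comm]

/-- Expansion of an endomorphism in the matrix units of a frame. -/
lemma IsFrameAt.end_eq {e : Fin n → Sections m n E} {y : M} (he : IsFrameAt e y)
    (a : EndAlg m n E) :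
    a y = (∑ p : Fin n × Fin n, herm (e p.1) (toEnd a (e p.2)) • ketbra (e p.1) (e p.2)) y := by
  refine end_apply_eq fun s => ?_
  rw [he.apply_eq_sum, EndAlg.sum_apply, LinearMap.sum_apply, Fintype.sum_prod_type_right]
  refine Finset.sum_congr rfl fun j _ => ?_
  simp only [EndAlg.smul_apply, LinearMap.smul_apply, ketbra_apply]
  conv_lhs => rw [← toEnd_apply_apply, ← he.sum_eq (toEnd a (e j)), Finset.smul_sum]
  exact Finset.sum_congr rfl fun i _ => smul_comm _ _ _

/-! ### Trace-free endomorphisms -/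

lemma trace_one : trace (1 : EndAlg m n E) = algebraMap ℂ (SmoothFun m M) n :=
  SmoothFun.ext fun x => by
    have hx := FiberBundle.mem_baseSet_trivializationAt' (F := Fin n → ℂ) (E := E) x
    rw [trace_apply, EndAlg.one_apply, ← map_one (algebraMap ℂ (Module.End ℂ (E x))),
      trace_eq_endMatrix _ hx, endMatrix_smul_one _ hx,
      SmoothFun.algebraMap_apply, Matrix.trace_smul, Matrix.trace_one, Fintype.card_fin,
      smul_eq_mul, one_mul]

lemma mem_traceFree {a : EndAlg m n E} : a ∈ traceFree m n E ↔ trace a = 0 :=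
  ⟨fun h => SmoothFun.ext h, fun h x => congrArg (fun u : SmoothFun m M => u x) h⟩

/-- The trace-free part `a - (tr a / n) 1`. -/
noncomputable def traceFreePart [NeZero n] : EndAlg m n E →ₗ[SmoothFun m M] EndAlg₀ m n E :=
  LinearMap.codRestrict (traceFree m n E)
    (LinearMap.id - (LinearMap.toSpanSingleton _ _
      (algebraMap ℂ (SmoothFun m M) (n : ℂ)⁻¹ • (1 : EndAlg m n E))).comp trace) fun a => by
    rw [mem_traceFree]
    change trace (a - trace a • (algebraMap ℂ (SmoothFun m M) (n : ℂ)⁻¹ •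
      (1 : EndAlg m n E))) = 0
    rw [map_sub, map_smul, map_smul, trace_one, smul_eq_mul, smul_eq_mul, ← map_mul,
      inv_mul_cancel₀ (Nat.cast_ne_zero.2 (NeZero.ne n)), map_one, mul_one, sub_self]

lemma coe_traceFreePart [NeZero n] (a : EndAlg m n E) :
    (traceFreePart a).1 = a - (trace a * algebraMap ℂ (SmoothFun m M) (n : ℂ)⁻¹) • 1 := by
  rw [mul_smul]
  rfl

lemma traceFreePart_coe [NeZero n] (γ : EndAlg₀ m n E) : traceFreePart γ.1 = γ := by
  refine Subtype.ext ?_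
  rw [coe_traceFreePart, mem_traceFree.1 γ.2, zero_mul, zero_smul, sub_zero]

lemma ad_smul_one (f : SmoothFun m M) : ad (f • (1 : EndAlg m n E)) = 0 := Der.ext fun a => by
  rw [ad_apply, smul_mul_assoc, one_mul, mul_smul_comm, mul_one, sub_self]
  rfl

lemma ad₀_apply (γ : EndAlg₀ m n E) : ad₀ γ = ad γ.1 := rfl

lemma ad₀_traceFreePart [NeZero n] (a : EndAlg m n E) : ad₀ (traceFreePart a) = ad a := by
  rw [ad₀_apply, coe_traceFreePart, map_sub, ad_smul_one, sub_zero]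

/-- An endomorphism of the fibre that commutes with all others and has trace zero vanishes. -/
lemma end_apply_eq_zero [NeZero n] {a : EndAlg m n E} {y : M} (ha : trace a y = 0)
    (h : ∀ b : EndAlg m n E, ad a b y = 0) : a y = 0 := by
  have hx := FiberBundle.mem_baseSet_trivializationAt' (F := Fin n → ℂ) (E := E) y
  obtain ⟨c, hc⟩ : ∃ c : ℂ, algebraMap ℂ (Module.End ℂ (E y)) c = a y := by
    have h : a y ∈ Subalgebra.center ℂ (Module.End ℂ (E y)) := by
      rw [Subalgebra.mem_center_iff]
      intro T
      obtain ⟨b, rfl⟩ := exists_end (m := m) (n := n) y T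
      exact (sub_eq_zero.1 (h b)).symm
    exact Algebra.mem_bot.1 (Algebra.IsCentral.out h)
  rw [trace_apply, ← hc, trace_eq_endMatrix _ hx, endMatrix_smul_one _ hx, Matrix.trace_smul,
    Matrix.trace_one, Fintype.card_fin, smul_eq_mul, mul_eq_zero,
    or_iff_left (Nat.cast_ne_zero.2 (NeZero.ne n))] at ha
  rw [← hc, ha, map_zero]

/-! ### Representing linear forms by pointwise nondegenerate bilinear forms -/

/-- A `C^∞(M)`-linear form on `A` is tensorial: it is computed in a local frame. -/
lemma linearForm_apply (F : EndAlg m n E →ₗ[SmoothFun m M] SmoothFun m M)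
    {e : Fin n → Sections m n E} {x : M} (he : ∀ᶠ y in nhds x, IsFrameAt e y)
    (b : EndAlg m n E) :
    F b x = ∑ p : Fin n × Fin n,
      herm (e p.1) (toEnd b (e p.2)) x * F (ketbra (e p.1) (e p.2)) x := by
  obtain ⟨φ, hφx, -, hφ⟩ := exists_cutoff (m := m) he
  have h : φ • b = φ • ∑ p : Fin n × Fin n,
      herm (e p.1) (toEnd b (e p.2)) • ketbra (e p.1) (e p.2) := EndAlg.ext fun y => by
    rcases hφ y with hy | hy
    · simp only [EndAlg.smul_apply, hy, zero_smul]
    · rw [EndAlg.smul_apply, EndAlg.smul_apply, ← hy.end_eq]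
  have h1 := congrArg (fun u : SmoothFun m M => u x) (congrArg F h)
  simpa only [map_smul, map_sum, SmoothFun.smul_apply, SmoothFun.sum_apply, hφx, one_mul] using h1

/-- A bilinear form on `A` that is nondegenerate at every point represents every linear form. In
a local frame the solution is given by Cramer's rule; it is unique at each point, so that the
local solutions glue. -/
theorem exists_represents (k : LinearMap.BilinForm (SmoothFun m M) (EndAlg m n E))
    (hk : ∀ x a, (∀ b, k a b x = 0) → a x = 0)
    (F : EndAlg m n E →ₗ[SmoothFun m M] SmoothFun m M) : ∃ a, ∀ b, k a b = F b := by
  have hloc : ∀ x, ∃ a : EndAlg m n E, ∀ᶠ y in nhds x, ∀ b, k a b y = F b y := by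
    intro x
    obtain ⟨e, he⟩ := exists_isFrameAt (m := m) (n := n) (E := E) x
    let B : Fin n × Fin n → EndAlg m n E := fun p => ketbra (e p.1) (e p.2)
    let K : Matrix (Fin n × Fin n) (Fin n × Fin n) (SmoothFun m M) :=
      Matrix.of fun p q => k (B p) (B q)
    -- a vector in the left kernel of the Gram matrix `K x` gives an element of `A` that is
    -- `k`-orthogonal at `x` to all of `A`
    have hdet : K.det x ≠ 0 := by
      rw [← SmoothFun.eval_apply, RingHom.map_det]
      intro h0
      obtain ⟨v, hv, hv0⟩ := Matrix.exists_vecMul_eq_zero_iff.2 h0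
      apply hv
      set a : EndAlg m n E := ∑ p, algebraMap ℂ (SmoothFun m M) (v p) • B p with ha
      have h1 : ∀ q, k a (B q) x = 0 := fun q => by
        have := congrFun hv0 q
        rw [ha, map_sum, LinearMap.sum_apply]
        simp only [map_smul, LinearMap.smul_apply, SmoothFun.sum_apply, SmoothFun.smul_apply,
          SmoothFun.algebraMap_apply]
        exact this
      have h2 : a x = 0 := hk x a fun b => by
        rw [linearForm_apply (k a) he]
        exact Finset.sum_eq_zero fun p _ => by rw [h1 p, mul_zero]
      funext p
      have h3 : herm (e p.1) (toEnd a (e p.2)) x = v p := by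
        have h4 : toEnd a (e p.2) x = ∑ q, (v q * herm (e q.2) (e p.2) x) • e q.1 x := by
          rw [toEnd_apply_apply, ha, EndAlg.sum_apply, LinearMap.sum_apply]
          refine Finset.sum_congr rfl fun q _ => ?_
          rw [EndAlg.smul_apply, LinearMap.smul_apply, ketbra_apply, smul_smul]
          rfl
        rw [herm_apply, h4, hermAt_sum_smul_right]
        simp only [← herm_apply, he.self_of_nhds.herm_eq]
        rw [Finset.sum_eq_single p]
        · simp
        · intro q _ hq
          by_cases h5 : q.2 = p.2
          · have h6 : p.1 ≠ q.1 := fun h => hq (Prod.ext h.symm h5)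
            simp [h6]
          · simp [h5]
        · simp
      rw [← h3, herm_apply, toEnd_apply_apply, h2, LinearMap.zero_apply, ← zero_smul ℂ (0 : E x),
        hermAt_smul_right, zero_mul, Pi.zero_apply]
    obtain ⟨d, hd⟩ := exists_local_inv hdet
    refine ⟨d • ∑ p, Matrix.vecMul (fun q => F (B q)) K.adjugate p • B p, ?_⟩
    -- Cramer's rule, without dividing by the determinant, holds globally on the matrix units
    have hC : ∀ q, k (∑ p, Matrix.vecMul (fun q => F (B q)) K.adjugate p • B p) (B q) =
        K.det * F (B q) := fun q => by
      have h : Matrix.vecMul (Matrix.vecMul (fun q => F (B q)) K.adjugate) K q =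
          K.det * F (B q) := by
        rw [Matrix.vecMul_vecMul, Matrix.adjugate_mul, Matrix.vecMul_smul, Matrix.vecMul_one]
        rfl
      rw [← h, map_sum, LinearMap.sum_apply]
      simp only [map_smul, LinearMap.smul_apply]
      rfl
    filter_upwards [he.eventually_nhds, hd] with y hy hdy b
    rw [linearForm_apply (k _) hy, linearForm_apply F hy]
    refine Finset.sum_congr rfl fun p _ => ?_
    rw [map_smul, LinearMap.smul_apply, hC, SmoothFun.smul_apply, SmoothFun.mul_apply,
      ← mul_assoc (d y), hdy, one_mul]
  choose a ha using hloc
  obtain ⟨c, hc⟩ := exists_glue_end a fun x => by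
    filter_upwards [ha x] with y hy
    refine sub_eq_zero.1 (hk y (a x - a y) fun b => ?_)
    rw [map_sub, LinearMap.sub_apply, SmoothFun.sub_apply, hy, (ha y).self_of_nhds, sub_self]
  refine ⟨c, fun b => SmoothFun.ext fun x => ?_⟩
  obtain ⟨e, he⟩ := exists_isFrameAt (m := m) (n := n) (E := E) x
  rw [← (ha x).self_of_nhds b]
  change k.flip b c x = k.flip b (a x) x
  rw [linearForm_apply (k.flip b) he c, linearForm_apply (k.flip b) he (a x)]
  simp only [herm_apply, toEnd_apply_apply, hc]

/-- The inner metric identifies `A₀` with its dual: for a nondegenerate inner form `μ` on `A₀`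
and a linear form `F` on `A₀` there is `γ ∈ A₀` with `μ(γ, ·) = F`. -/
theorem exists_represents_traceFree [NeZero n]
    (μ : LinearMap.BilinForm (SmoothFun m M) (EndAlg₀ m n E)) (hμ : IsNondegenerateInner μ)
    (F : EndAlg₀ m n E →ₗ[SmoothFun m M] SmoothFun m M) :
    ∃ γ : EndAlg₀ m n E, ∀ η, μ γ η = F η := by
  -- the form on `A` that extends `μ` and makes the scalars orthogonal to `A₀`
  let k : LinearMap.BilinForm (SmoothFun m M) (EndAlg m n E) :=
    pullback traceFreePart μ + pullback trace (LinearMap.mul (SmoothFun m M) (SmoothFun m M))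
  have hk : ∀ a b, k a b = μ (traceFreePart a) (traceFreePart b) + trace a * trace b :=
    fun a b => rfl
  have hk0 : ∀ x a, (∀ b, k a b x = 0) → a x = 0 := by
    intro x a h
    have h1 : (traceFreePart a) x = 0 := hμ x _ fun η => by
      have := h η.1
      rwa [hk, mem_traceFree.1 η.2, mul_zero, add_zero, traceFreePart_coe] at this
    have h2 : trace a x = 0 := by
      have := h (algebraMap _ _ (1 : SmoothFun m M))
      rw [hk, map_one, SmoothFun.add_apply, SmoothFun.mul_apply, trace_one,
        SmoothFun.algebraMap_apply] at this
      have h3 : traceFreePart (1 : EndAlg m n E) = 0 := Subtype.ext <| by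
        rw [coe_traceFreePart, trace_one, ← map_mul,
          mul_inv_cancel₀ (Nat.cast_ne_zero.2 (NeZero.ne n)), map_one, one_smul, sub_self]
        rfl
      rw [h3, map_zero, SmoothFun.zero_apply, zero_add, mul_eq_zero] at this
      exact this.resolve_right (Nat.cast_ne_zero.2 (NeZero.ne n))
    rw [coe_traceFreePart, EndAlg.sub_apply, EndAlg.smul_apply, SmoothFun.mul_apply, h2,
      zero_mul, zero_smul, sub_zero] at h1
    exact h1
  obtain ⟨a, ha⟩ := exists_represents k hk0 (F.comp traceFreePart)
  refine ⟨traceFreePart a, fun η => ?_⟩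
  have h := ha η.1
  rwa [hk, mem_traceFree.1 η.2, mul_zero, add_zero, LinearMap.comp_apply,
    traceFreePart_coe] at h

/-! ### Derivations and determinants -/

lemma derivation_prod {R A ι : Type*} [CommRing R] [CommRing A] [Algebra R A] [DecidableEq ι]
    (X : Derivation R A A) (t : Finset ι) (f : ι → A) :
    X (∏ i ∈ t, f i) = ∑ k ∈ t, X (f k) * ∏ i ∈ t.erase k, f i := by
  induction t using Finset.induction_on with
  | empty => simp
  | insert j t hj ih =>
    rw [Finset.prod_insert hj, Derivation.leibniz, ih, Finset.sum_insert hj,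
      Finset.erase_insert hj, smul_eq_mul, smul_eq_mul, Finset.mul_sum, add_comm,
      mul_comm (X (f j))]
    congr 1
    refine Finset.sum_congr rfl fun k hk => ?_
    have hkj : k ≠ j := fun h => hj (h ▸ hk)
    rw [Finset.erase_insert_of_ne hkj.symm,
      Finset.prod_insert fun h => hj (Finset.mem_of_mem_erase h)]
    ring

/-- The derivative of a determinant, column by column. -/
lemma derivation_det {R A ι : Type*} [CommRing R] [CommRing A] [Algebra R A] [DecidableEq ι]
    [Fintype ι] (X : Derivation R A A) (S : Matrix ι ι A) :
    X S.det = ∑ k, (S.updateCol k fun i => X (S i k)).det := by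
  simp only [Matrix.det_apply', map_sum]
  rw [Finset.sum_comm]
  refine Finset.sum_congr rfl fun σ _ => ?_
  have hs : X ((Equiv.Perm.sign σ : ℤ) : A) = 0 := Derivation.map_intCast X _
  rw [Derivation.leibniz, hs, smul_zero, add_zero, derivation_prod, smul_eq_mul, Finset.mul_sum]
  refine Finset.sum_congr rfl fun k _ => ?_
  congr 1
  rw [← Finset.mul_prod_erase _ _ (Finset.mem_univ k), Matrix.updateCol_self]
  congr 1
  refine Finset.prod_congr rfl fun i hi => ?_
  rw [Matrix.updateCol_ne (Finset.ne_of_mem_erase hi)]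

/-! ### Special first-order operators on `Γ(E)` -/

/-- The operator `D` on `Γ(E)` satisfies the Leibniz rule for the vector field `X`, preserves the
volume form, and induces the derivation `𝒳 = [D, ·]` of `A`. -/
structure IsSpecialOp (X : VectorField m M) (D : Sections m n E →ₗ[ℂ] Sections m n E)
    (𝒳 : Der m n E) : Prop where
  leibniz : ∀ (f : SmoothFun m M) (s : Sections m n E), D (f • s) = X f • s + f • D s
  special : ∀ s : Fin n → Sections m n E,
    X (vol s) = ∑ k, vol (Function.update s k (D (s k)))
  comm : ∀ (a : EndAlg m n E) (s : Sections m n E),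
    toEnd (𝒳 a) s = D (toEnd a s) - toEnd a (D s)

/-- An operator with a Leibniz rule induces a derivation of `A`. -/
lemma exists_commutator (X : VectorField m M) (D : Sections m n E →ₗ[ℂ] Sections m n E)
    (hD : ∀ (f : SmoothFun m M) (s : Sections m n E), D (f • s) = X f • s + f • D s) :
    ∃ 𝒳 : Der m n E, ∀ (a : EndAlg m n E) (s : Sections m n E),
      toEnd (𝒳 a) s = D (toEnd a s) - toEnd a (D s) := by
  let C : EndAlg m n E → Module.End (SmoothFun m M) (Sections m n E) := fun a =>
    { toFun := fun s => D (toEnd a s) - toEnd a (D s)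
      map_add' := fun s t => by
        rw [map_add, map_add, map_add, map_add]
        abel
      map_smul' := fun f s => by
        rw [map_smul, hD, hD, map_add, map_smul, map_smul, RingHom.id_apply, smul_sub]
        abel }
  have hC : ∀ a s, toEnd (endEquiv.symm (C a)) s = D (toEnd a s) - toEnd a (D s) :=
    fun a s => toEnd_endEquiv_symm (C a) s
  refine ⟨⟨⟨⟨fun a => endEquiv.symm (C a), fun a b => ?_⟩, fun c a => ?_⟩, fun a b => ?_⟩, hC⟩
  · refine eq_of_toEnd fun s => ?_
    rw [map_add toEnd, LinearMap.add_apply, hC, hC, hC, map_add toEnd, LinearMap.add_apply,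
      LinearMap.add_apply, map_add D]
    abel
  · refine eq_of_toEnd fun s => ?_
    have h : ∀ (b : EndAlg m n E) (t : Sections m n E), toEnd (c • b) t = c • toEnd b t :=
      fun _ _ => rfl
    rw [RingHom.id_apply, h, hC, hC, h, h, map_smul D, smul_sub]
  · refine eq_of_toEnd fun s => ?_
    change toEnd (endEquiv.symm (C (a * b))) s =
      toEnd (endEquiv.symm (C a) * b + a * endEquiv.symm (C b)) s
    simp only [map_add toEnd, map_mul toEnd, LinearMap.add_apply, Module.End.mul_apply, hC,
      map_sub (toEnd a)]
    abel

/-- The special operators whose induced derivations are `h`-orthogonal to the inner derivations,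
together with their vector fields and their induced derivations. -/
noncomputable def orthogonalOps (h : LinearMap.BilinForm (SmoothFun m M) (Der m n E)) :
    Submodule (SmoothFun m M)
      (VectorField m M × (Sections m n E →ₗ[ℂ] Sections m n E) × Der m n E) where
  carrier := {p | IsSpecialOp p.1 p.2.1 p.2.2 ∧ ∀ γ, h p.2.2 (ad γ) = 0}
  add_mem' {p q} hp hq := by
    refine ⟨⟨fun f s => ?_, fun s => ?_, fun a s => ?_⟩, fun γ => ?_⟩
    · change p.2.1 (f • s) + q.2.1 (f • s) = (p.1 f + q.1 f) • s + f • (p.2.1 s + q.2.1 s)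
      rw [hp.1.leibniz, hq.1.leibniz, add_smul, smul_add]
      abel
    · change p.1 (vol s) + q.1 (vol s) =
        ∑ k, vol (Function.update s k (p.2.1 (s k) + q.2.1 (s k)))
      simp only [vol_update_add, Finset.sum_add_distrib]
      rw [hp.1.special, hq.1.special]
    · change toEnd (p.2.2 a + q.2.2 a) s =
        p.2.1 (toEnd a s) + q.2.1 (toEnd a s) - toEnd a (p.2.1 s + q.2.1 s)
      rw [map_add, LinearMap.add_apply, hp.1.comm, hq.1.comm, map_add]
      abel
    · change h (p.2.2 + q.2.2) (ad γ) = 0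
      rw [map_add, LinearMap.add_apply, hp.2, hq.2, add_zero]
  zero_mem' := by
    refine ⟨⟨fun f s => ?_, fun s => ?_, fun a s => ?_⟩, fun γ => ?_⟩
    · change (0 : Sections m n E) = (0 : SmoothFun m M) • s + f • (0 : Sections m n E)
      rw [zero_smul, smul_zero, add_zero]
    · change (0 : SmoothFun m M) = ∑ k, vol (Function.update s k (0 : Sections m n E))
      refine (Finset.sum_eq_zero fun k _ => ?_).symm
      rw [← zero_smul (SmoothFun m M) (0 : Sections m n E), vol_update_smul, zero_mul]
    · change toEnd (0 : EndAlg m n E) s = 0 - toEnd a (0 : Sections m n E)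
      rw [map_zero, map_zero, LinearMap.zero_apply, sub_zero]
    · change h 0 (ad γ) = 0
      rw [map_zero, LinearMap.zero_apply]
  smul_mem' g p hp := by
    refine ⟨⟨fun f s => ?_, fun s => ?_, fun a s => ?_⟩, fun γ => ?_⟩
    · change g • p.2.1 (f • s) = (g * p.1 f) • s + f • g • p.2.1 s
      rw [hp.1.leibniz, smul_add, mul_smul, smul_comm f]
    · change g * p.1 (vol s) = ∑ k, vol (Function.update s k (g • p.2.1 (s k)))
      simp only [vol_update_smul]
      rw [← Finset.mul_sum, hp.1.special]
    · change toEnd (g • p.2.2 a) s = g • p.2.1 (toEnd a s) - toEnd a (g • p.2.1 s)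
      rw [map_smul, LinearMap.smul_apply, hp.1.comm, map_smul, smul_sub]
    · change h (g • p.2.2) (ad γ) = 0
      rw [map_smul, LinearMap.smul_apply, hp.2, smul_zero]

/-- The inner metric detects vanishing: `γ ∈ A₀` is zero if `ad γ` is orthogonal to `A₀`. -/
lemma eq_zero_of_orthogonal {h : LinearMap.BilinForm (SmoothFun m M) (Der m n E)}
    (hinner : IsNondegenerateInner (pullback ad₀ h)) {γ : EndAlg₀ m n E}
    (hγ : ∀ η : EndAlg₀ m n E, h (ad₀ γ) (ad₀ η) = 0) : γ = 0 := by
  refine Subtype.ext (EndAlg.ext fun x => hinner x γ fun η => ?_)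
  change h (ad₀ γ) (ad₀ η) x = 0
  rw [hγ η, SmoothFun.zero_apply]

/-- Special orthogonal operators are determined by their vector fields: a special operator over
the zero vector field is a trace-free endomorphism. -/
lemma orthogonalOps_eq_zero {h : LinearMap.BilinForm (SmoothFun m M) (Der m n E)}
    (hinner : IsNondegenerateInner (pullback ad₀ h))
    {p : VectorField m M × (Sections m n E →ₗ[ℂ] Sections m n E) × Der m n E}
    (hp : p ∈ orthogonalOps h) (h0 : p.1 = 0) : p = 0 := by
  obtain ⟨X, T, 𝒯⟩ := p
  obtain ⟨⟨hl, hs, hc⟩, ho⟩ := hp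
  simp only at h0 hl hs hc ho
  subst h0
  let β : EndAlg m n E := endEquiv.symm
    { toFun := T
      map_add' := T.map_add
      map_smul' := fun f s => by rw [hl, Derivation.zero_apply, zero_smul, zero_add]; rfl }
  have hβ : ∀ s, toEnd β s = T s := fun s => toEnd_endEquiv_symm _ s
  have htr : trace β = 0 := SmoothFun.ext fun x => by
    obtain ⟨e, he⟩ := exists_isFrameAt (m := m) (n := n) (E := E) x
    have h1 := hs e
    simp only [← hβ] at h1
    rw [sum_vol_update_toEnd] at h1
    have h2 := congrArg (fun u : SmoothFun m M => u x) h1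
    rw [Derivation.zero_apply] at h2
    simpa [he.self_of_nhds.vol_self] using h2.symm
  have h𝒯 : 𝒯 = ad β := Der.ext fun a => eq_of_toEnd fun s => by
    rw [hc, ad_apply, map_sub, LinearMap.sub_apply, map_mul, map_mul, Module.End.mul_apply,
      Module.End.mul_apply, hβ, hβ]
  have hβ0 : (⟨β, mem_traceFree.2 htr⟩ : EndAlg₀ m n E) = 0 :=
    eq_zero_of_orthogonal hinner fun η => by
      change h (ad β) (ad η.1) = 0
      rw [← h𝒯, ho]
  have hβ1 : β = 0 := congrArg Subtype.val hβ0
  have hT : T = 0 := LinearMap.ext fun s => by rw [← hβ, hβ1, map_zero]; rfl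
  rw [h𝒯, hβ1, hT, map_zero]
  rfl

/-- In a local frame, differentiation of the coefficients along a vector field is a special
operator; here it is cut off near a point. -/
lemma exists_local_specialOp (X : VectorField m M) (x : M) :
    ∃ (φ : SmoothFun m M) (D : Sections m n E →ₗ[ℂ] Sections m n E) (𝒟 : Der m n E),
      (∀ᶠ y in nhds x, φ y = 1) ∧ IsSpecialOp (φ • X) D 𝒟 := by
  obtain ⟨e, he⟩ := exists_isFrameAt (m := m) (n := n) (E := E) x
  obtain ⟨φ, -, hφ1, hφ⟩ := exists_cutoff (m := m) he.eventually_nhds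
  let D : Sections m n E →ₗ[ℂ] Sections m n E :=
    { toFun := fun s => φ • ∑ j, X (herm (e j) s) • e j
      map_add' := fun s t => by
        simp only [herm_add_right, map_add, add_smul, Finset.sum_add_distrib, smul_add]
      map_smul' := fun c s => by
        have h : ∀ j, herm (e j) (c • s) = c • herm (e j) s := fun j =>
          (hermₗ (e j)).map_smul_of_tower c s
        simp only [h, RingHom.id_apply, X.map_smul, smul_assoc, ← Finset.smul_sum]
        rw [smul_comm] }
  have hDs : ∀ s, D s = φ • ∑ j, X (herm (e j) s) • e j := fun s => rfl
  have hl : ∀ (f : SmoothFun m M) (s : Sections m n E),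
      D (f • s) = (φ • X) f • s + f • D s := fun f s => by
    have h : φ • ∑ j, herm (e j) s • e j = φ • s := Sections.ext fun y => by
      rcases hφ y with hy | hy
      · simp only [Sections.smul_apply, hy, zero_smul]
      · simp only [Sections.smul_apply, Sections.sum_apply, hy.self_of_nhds.sum_eq]
    rw [Derivation.smul_apply, hDs, hDs, smul_assoc, smul_comm φ, ← h, smul_comm f φ,
      smul_comm (X f) φ, ← smul_add]
    congr 1
    rw [Finset.smul_sum, Finset.smul_sum, ← Finset.sum_add_distrib]
    refine Finset.sum_congr rfl fun j _ => ?_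
    rw [herm_smul_right, Derivation.leibniz, add_smul, smul_assoc, smul_assoc, add_comm,
      smul_comm (herm (e j) s) (X f)]
  obtain ⟨𝒟, h𝒟⟩ := exists_commutator (φ • X) D hl
  refine ⟨φ, D, 𝒟, hφ1, hl, fun s => SmoothFun.ext fun y => ?_, h𝒟⟩
  rw [Derivation.smul_apply, SmoothFun.smul_apply, SmoothFun.sum_apply]
  simp only [hDs, vol_update_smul, SmoothFun.mul_apply, ← Finset.mul_sum]
  rcases hφ y with hy | hy
  · rw [hy, zero_mul, zero_mul]
  congr 1
  -- near `y` the volume is a determinant of smooth functions, differentiated column by column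
  let S : Matrix (Fin n) (Fin n) (SmoothFun m M) := Matrix.of fun i j => herm (e i) (s j)
  have h1 : ∀ᶠ z in nhds y, vol s z = S.det z := by
    filter_upwards [hy] with z hz
    rw [hz.vol_eq, ← SmoothFun.eval_apply, RingHom.map_det]
    rfl
  rw [field_congr X h1, derivation_det, SmoothFun.sum_apply]
  refine Finset.sum_congr rfl fun k _ => ?_
  rw [hy.self_of_nhds.vol_update, ← SmoothFun.eval_apply, RingHom.map_det]
  congr 1
  ext i j
  rw [RingHom.mapMatrix_apply, Matrix.map_apply, Matrix.updateCol_apply, Matrix.updateCol_apply]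
  split_ifs with hj
  · rw [← hermₗ_apply, map_sum, SmoothFun.sum_apply]
    simp only [map_smul, SmoothFun.smul_apply, hermₗ_apply, hy.self_of_nhds.herm_eq]
    simp [S]
  · rfl

/-- Near every point there is a special orthogonal operator over a given vector field: the inner
part of an arbitrary special operator is removed by means of the inner metric. -/
lemma exists_local_orthogonalOp [NeZero n]
    {h : LinearMap.BilinForm (SmoothFun m M) (Der m n E)}
    (hinner : IsNondegenerateInner (pullback ad₀ h)) (X : VectorField m M) (x : M) :
    ∃ (φ : SmoothFun m M) (D : Sections m n E →ₗ[ℂ] Sections m n E) (𝒟 : Der m n E),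
      (∀ᶠ y in nhds x, φ y = 1) ∧ (φ • X, D, 𝒟) ∈ orthogonalOps h := by
  obtain ⟨φ, D, 𝒟, hφ, hl, hs, hc⟩ := exists_local_specialOp (n := n) (E := E) X x
  obtain ⟨β, hβ⟩ := exists_represents_traceFree (pullback ad₀ h) hinner ((h 𝒟).comp ad₀)
  refine ⟨φ, D - (toEnd β.1).restrictScalars ℂ, 𝒟 - ad β.1, hφ,
    ⟨fun f s => ?_, fun s => ?_, fun a s => ?_⟩, fun γ => ?_⟩
  · change D (f • s) - toEnd β.1 (f • s) = (φ • X) f • s + f • (D s - toEnd β.1 s)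
    rw [hl, map_smul, smul_sub]
    abel
  · change (φ • X) (vol s) = ∑ k, vol (Function.update s k (D (s k) - toEnd β.1 (s k)))
    have h1 : ∀ k, vol (Function.update s k (D (s k) - toEnd β.1 (s k))) =
        vol (Function.update s k (D (s k))) - vol (Function.update s k (toEnd β.1 (s k))) :=
      fun k => by
        rw [eq_sub_iff_add_eq, ← vol_update_add, sub_add_cancel]
    simp only [h1, Finset.sum_sub_distrib]
    rw [sum_vol_update_toEnd, mem_traceFree.1 β.2, zero_mul, sub_zero, hs]
  · change toEnd (𝒟 a - ad β.1 a) s =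
      D (toEnd a s) - toEnd β.1 (toEnd a s) - toEnd a (D s - toEnd β.1 s)
    rw [map_sub, LinearMap.sub_apply, hc, ad_apply, map_sub, LinearMap.sub_apply, map_mul, map_mul,
      Module.End.mul_apply, Module.End.mul_apply, map_sub]
    abel
  · change h (𝒟 - ad β.1) (ad γ) = 0
    have h1 := hβ (traceFreePart γ)
    change h (ad₀ β) (ad₀ (traceFreePart γ)) = h 𝒟 (ad₀ (traceFreePart γ)) at h1
    rw [ad₀_traceFreePart, ad₀_apply] at h1
    rw [map_sub, LinearMap.sub_apply, h1, sub_self]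

/-- The local special orthogonal operators glue, as they are unique. -/
lemma exists_orthogonalOp [NeZero n]
    {h : LinearMap.BilinForm (SmoothFun m M) (Der m n E)}
    (hinner : IsNondegenerateInner (pullback ad₀ h)) (X : VectorField m M) :
    ∃ (D : Sections m n E →ₗ[ℂ] Sections m n E) (𝒟 : Der m n E),
      (X, D, 𝒟) ∈ orthogonalOps h := by
  choose φ D 𝒟 hφ hD using fun x => exists_local_orthogonalOp hinner X x
  -- near `x`, the local operators at `x` and at nearby points agree
  have hglue : ∀ x, ∀ᶠ y in nhds x, ∀ s, D x s y = D y s y := fun x => by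
    filter_upwards [(hφ x).eventually_nhds] with y hy s
    obtain ⟨ψ, hψy, -, hψ⟩ := exists_cutoff (m := m) (hy.and (hφ y))
    have h1 := (orthogonalOps h).smul_mem ψ ((orthogonalOps h).sub_mem (hD x) (hD y))
    have h2 : ψ • (φ x • X - φ y • X) = 0 := by
      rw [← sub_smul, smul_smul]
      have h3 : ψ * (φ x - φ y) = 0 := SmoothFun.ext fun z => by
        rcases hψ z with hz | hz
        · rw [SmoothFun.mul_apply, hz, zero_mul, SmoothFun.zero_apply]
        · rw [SmoothFun.mul_apply, SmoothFun.sub_apply, hz.1, hz.2, sub_self, mul_zero,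
            SmoothFun.zero_apply]
      rw [h3, zero_smul]
    have h4 := orthogonalOps_eq_zero hinner h1 h2
    have h5 : ψ • (D x s - D y s) = 0 := LinearMap.congr_fun (congrArg (fun p => p.2.1) h4) s
    have h6 := congrArg (fun t : Sections m n E => t y) h5
    simpa [hψy, sub_eq_zero] using h6
  choose D' hD' using fun s => exists_glue_sections (fun x => D x s) fun x =>
    (hglue x).mono fun y hy => hy s
  let G : Sections m n E →ₗ[ℂ] Sections m n E :=
    { toFun := D'
      map_add' := fun s t => Sections.ext fun x => by
        rw [hD', map_add, Sections.add_apply, Sections.add_apply, hD', hD']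
      map_smul' := fun c s => Sections.ext fun x => by
        rw [hD', map_smul]
        change c • D x s x = c • D' s x
        rw [hD'] }
  have hG : ∀ x s, G s x = D x s x := fun x s => hD' s x
  have hφx : ∀ x, φ x x = 1 := fun x => (hφ x).self_of_nhds
  have hl : ∀ (f : SmoothFun m M) (s : Sections m n E),
      G (f • s) = X f • s + f • G s := fun f s => Sections.ext fun x => by
    rw [hG, (hD x).1.leibniz]
    simp [hG, hφx]
  obtain ⟨𝒢, h𝒢⟩ := exists_commutator X G hl
  refine ⟨G, 𝒢, ⟨hl, fun s => SmoothFun.ext fun x => ?_, h𝒢⟩, fun γ => SmoothFun.ext fun x => ?_⟩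
  · have h1 := congrArg (fun u : SmoothFun m M => u x) ((hD x).1.special s)
    simp only [Derivation.smul_apply, SmoothFun.smul_apply, SmoothFun.sum_apply, hφx,
      one_mul] at h1
    rw [h1, SmoothFun.sum_apply]
    exact Finset.sum_congr rfl fun k _ => vol_update_congr s k (hG x _).symm
  · obtain ⟨ψ, hψx, -, hψ⟩ := exists_cutoff (m := m) (hglue x)
    have h1 : ψ • 𝒢 = ψ • 𝒟 x := Der.ext fun a => eq_of_toEnd fun s => Sections.ext fun y => by
      rw [Der.smul_apply, Der.smul_apply, map_smul, map_smul, LinearMap.smul_apply,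
        LinearMap.smul_apply, Sections.smul_apply, Sections.smul_apply]
      rcases hψ y with hy | hy
      · rw [hy, zero_smul, zero_smul]
      · rw [h𝒢, (hD x).1.comm]
        simp only [Sections.sub_apply, toEnd_apply_apply, hG, hy]
    have h2 : h (ψ • 𝒢) (ad γ) = 0 := by
      rw [h1, map_smul, LinearMap.smul_apply, (hD x).2, smul_zero]
    rw [map_smul, LinearMap.smul_apply] at h2
    have h3 := congrArg (fun u : SmoothFun m M => u x) h2
    simpa [hψx] using h3

/-! ### The orthogonal connection -/

lemma Connection.isSpecialOp (D : Connection m n E) (hD : D.IsSpecial) (X : VectorField m M) :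
    IsSpecialOp X (D.cov X) (D.onEnd X) :=
  ⟨D.leibniz X, hD X, D.onEnd_spec X⟩

theorem existsUnique_connection [NeZero n]
    {h : LinearMap.BilinForm (SmoothFun m M) (Der m n E)}
    (hinner : IsNondegenerateInner (pullback ad₀ h)) :
    ∃! D : Connection m n E, D.IsSpecial ∧ IsOrthogonal h D := by
  have huniq : ∀ {X : VectorField m M} {D D' : Sections m n E →ₗ[ℂ] Sections m n E}
      {𝒟 𝒟' : Der m n E}, (X, D, 𝒟) ∈ orthogonalOps h → (X, D', 𝒟') ∈ orthogonalOps h →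
      (D, 𝒟) = (D', 𝒟') := fun hD hD' => by
    have h1 := orthogonalOps_eq_zero hinner ((orthogonalOps h).sub_mem hD hD') (sub_self _)
    exact congrArg Prod.snd (sub_eq_zero.1 h1)
  choose C 𝒞 hC using exists_orthogonalOp (n := n) (E := E) hinner
  let D : Connection m n E :=
    { cov :=
        { toFun := C
          map_add' := fun X Y => congrArg Prod.fst
            (huniq (hC (X + Y)) ((orthogonalOps h).add_mem (hC X) (hC Y)))
          map_smul' := fun f X => congrArg Prod.fst
            (huniq (hC (f • X)) ((orthogonalOps h).smul_mem f (hC X))) }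
      leibniz := fun X => (hC X).1.leibniz }
  have hDC : ∀ X, D.onEnd X = 𝒞 X := fun X => Der.ext fun a => eq_of_toEnd fun s =>
    (D.onEnd_spec X a s).trans ((hC X).1.comm a s).symm
  refine ⟨D, ⟨fun X => (hC X).1.special, fun X γ => ?_⟩, fun D' hD' => ?_⟩
  · rw [hDC]
    exact (hC X).2 γ
  · refine Connection.ext (LinearMap.ext fun X => ?_)
    exact congrArg Prod.fst (huniq (D := D'.cov X) ⟨D'.isSpecialOp hD'.1 X, hD'.2 X⟩ (hC X))

/-! ### Vertical derivations are inner -/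

lemma smul_one_injective [NeZero n] :
    Function.Injective fun f : SmoothFun m M => f • (1 : EndAlg m n E) := fun f g hfg => by
  have h1 := congrArg trace hfg
  simp only [map_smul, trace_one] at h1
  refine SmoothFun.ext fun x => ?_
  have h2 := congrArg (fun u : SmoothFun m M => u x) h1
  simp only [SmoothFun.smul_apply, SmoothFun.algebraMap_apply] at h2
  exact mul_right_cancel₀ (Nat.cast_ne_zero.2 (NeZero.ne n)) h2

lemma rho_onEnd [NeZero n] (D : Connection m n E) (X : VectorField m M) :
    rho (D.onEnd X) = X := Derivation.ext fun f => smul_one_injective (n := n) (E := E) <| by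
  change rho (D.onEnd X) f • (1 : EndAlg m n E) = X f • 1
  rw [← rho_spec]
  refine eq_of_toEnd fun s => (D.onEnd_spec X _ s).trans ?_
  have h1 : ∀ (g : SmoothFun m M) (t : Sections m n E),
      applySection (g • (1 : EndAlg m n E)) t = g • t := fun g t => rfl
  have h2 : toEnd (X f • (1 : EndAlg m n E)) s = X f • s := rfl
  rw [h1, h1, h2, D.leibniz, add_sub_cancel_right]

lemma rho_ad [NeZero n] (γ : EndAlg m n E) : rho (ad γ) = 0 :=
  Derivation.ext fun f => smul_one_injective (n := n) (E := E) <| by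
    change rho (ad γ) f • (1 : EndAlg m n E) = (0 : SmoothFun m M) • 1
    rw [← rho_spec, ad_apply, mul_smul_comm, smul_mul_assoc, mul_one, one_mul, sub_self, zero_smul]

lemma ad₀_injective [NeZero n] :
    Function.Injective (ad₀ : EndAlg₀ m n E →ₗ[SmoothFun m M] Der m n E) := by
  rw [injective_iff_map_eq_zero]
  intro γ hγ
  refine Subtype.ext (EndAlg.ext fun x => end_apply_eq_zero (γ.2 x) fun b => ?_)
  rw [← ad₀_apply, hγ]
  rfl

/-- A derivation of `A` that vanishes on the centre is inner. If `e` is a section and `v` a dual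
one near a point, then `[T, ·]` with `T s = 𝒴(s ⊗ v) e` agrees with `𝒴` there; the trace-free
parts of these local solutions are unique and glue. -/
theorem exists_eq_ad₀ [NeZero n] {𝒴 : Der m n E} (h𝒴 : rho 𝒴 = 0) :
    ∃ γ : EndAlg₀ m n E, 𝒴 = ad₀ γ := by
  have hsmul : ∀ (f : SmoothFun m M) (a : EndAlg m n E), 𝒴 (f • a) = f • 𝒴 a := fun f a => by
    have h1 := 𝒴.2 (f • 1) a
    have h2 : 𝒴 (f • (1 : EndAlg m n E)) = 0 := by
      rw [rho_spec, h𝒴, Derivation.zero_apply, zero_smul]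
    rwa [smul_mul_assoc, one_mul, h2, zero_mul, zero_add, smul_mul_assoc, one_mul] at h1
  have hloc : ∀ x, ∃ γ : EndAlg₀ m n E, ∀ᶠ y in nhds x, ∀ b, ad₀ γ b y = 𝒴 b y := fun x => by
    obtain ⟨e, he⟩ := exists_isFrameAt (m := m) (n := n) (E := E) x
    let T : EndAlg m n E := endEquiv.symm
      { toFun := fun s => toEnd (𝒴 (ketbra s (e 0))) (e 0)
        map_add' := fun s t => by
          rw [ketbra_add_left, map_add 𝒴.1, map_add, LinearMap.add_apply]
        map_smul' := fun f s => by
          rw [ketbra_smul_left, hsmul, map_smul, LinearMap.smul_apply, RingHom.id_apply] }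
    have hT : ∀ s, toEnd T s = toEnd (𝒴 (ketbra s (e 0))) (e 0) :=
      fun s => toEnd_endEquiv_symm _ s
    refine ⟨traceFreePart T, he.mono fun y hy b => ?_⟩
    rw [ad₀_traceFreePart]
    refine end_apply_eq fun s => ?_
    have h1 : toEnd (ad T b) s = herm (e 0) (e 0) • toEnd (𝒴 b) s := by
      rw [ad_apply, map_sub, LinearMap.sub_apply, map_mul, map_mul, Module.End.mul_apply,
        Module.End.mul_apply, hT, hT, ← mul_ketbra, 𝒴.2, map_add, LinearMap.add_apply, map_mul,
        map_mul, Module.End.mul_apply, Module.End.mul_apply, add_sub_cancel_right, toEnd_ketbra,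
        map_smul]
    rw [← toEnd_apply_apply, h1, Sections.smul_apply, hy.herm_eq, if_pos rfl, one_smul,
      toEnd_apply_apply]
  choose γ hγ using hloc
  -- two local solutions differ by a trace-free endomorphism that commutes with `A`
  obtain ⟨c, hc⟩ := exists_glue_end (fun x => (γ x).1) fun x => by
    filter_upwards [hγ x] with y hy
    refine sub_eq_zero.1 (end_apply_eq_zero (a := (γ x).1 - (γ y).1) ?_ fun b => ?_)
    · rw [map_sub, mem_traceFree.1 (γ x).2, mem_traceFree.1 (γ y).2, sub_self,
        SmoothFun.zero_apply]
    · rw [map_sub, Der.sub_apply, EndAlg.sub_apply, ← ad₀_apply, ← ad₀_apply, hy,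
        (hγ y).self_of_nhds, sub_self]
  refine ⟨⟨c, fun x => ?_⟩, Der.ext fun b => EndAlg.ext fun x => ?_⟩
  · rw [hc]
    exact (γ x).2 x
  · rw [← (hγ x).self_of_nhds b]
    change (γ x).1 x * b x - b x * (γ x).1 x = c x * b x - b x * c x
    rw [hc]

/-! ### The decomposition of the metric -/

lemma pullback_apply {P Q : Type*} [AddCommGroup P] [Module (SmoothFun m M) P] [AddCommGroup Q]
    [Module (SmoothFun m M) Q] (φ : P →ₗ[SmoothFun m M] Q)
    (h : LinearMap.BilinForm (SmoothFun m M) Q) (p q : P) : pullback φ h p q = h (φ p) (φ q) :=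
  rfl

theorem exists_connectionForm [NeZero n] (D : Connection m n E) :
    ∃ α : Der m n E →ₗ[SmoothFun m M] EndAlg₀ m n E, IsConnectionForm D α := by
  have h1 : ∀ 𝒳 : Der m n E, ∃ γ : EndAlg₀ m n E, D.onEnd (rho 𝒳) - 𝒳 = ad₀ γ := fun 𝒳 =>
    exists_eq_ad₀ (by rw [map_sub, rho_onEnd, sub_self])
  choose α hα using h1
  refine ⟨{ toFun := α, map_add' := fun 𝒳 𝒴 => ad₀_injective ?_,
            map_smul' := fun f 𝒳 => ad₀_injective ?_ }, fun 𝒳 => ?_⟩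
  · rw [map_add, ← hα, ← hα, ← hα, map_add, map_add]
    abel
  · rw [RingHom.id_apply, map_smul, ← hα, ← hα, map_smul, map_smul, smul_sub]
  · change 𝒳 = D.onEnd (rho 𝒳) - ad₀ (α 𝒳)
    rw [← hα, sub_sub_cancel]

lemma IsConnectionForm.unique [NeZero n] {D : Connection m n E}
    {α α' : Der m n E →ₗ[SmoothFun m M] EndAlg₀ m n E} (hα : IsConnectionForm D α)
    (hα' : IsConnectionForm D α') : α' = α :=
  LinearMap.ext fun 𝒳 => ad₀_injective <|
    sub_right_injective ((hα' 𝒳).symm.trans (hα 𝒳))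

lemma IsConnectionForm.apply_onEnd [NeZero n] {D : Connection m n E}
    {α : Der m n E →ₗ[SmoothFun m M] EndAlg₀ m n E} (hα : IsConnectionForm D α)
    (X : VectorField m M) : α (D.onEnd X) = 0 := ad₀_injective <| by
  have h1 := hα (D.onEnd X)
  rw [rho_onEnd] at h1
  rw [map_zero, ← sub_right_injective ((sub_zero _).trans h1)]

lemma IsConnectionForm.apply_ad₀ [NeZero n] {D : Connection m n E}
    {α : Der m n E →ₗ[SmoothFun m M] EndAlg₀ m n E} (hα : IsConnectionForm D α)
    (γ : EndAlg₀ m n E) : α (ad₀ γ) = -γ := ad₀_injective <| by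
  have h1 := hα (ad₀ γ)
  rw [ad₀_apply γ, rho_ad, map_zero, zero_sub] at h1
  rw [map_neg]
  exact neg_eq_iff_eq_neg.1 h1.symm

section Decomposition

variable [NeZero n] {h : LinearMap.BilinForm (SmoothFun m M) (Der m n E)} {D : Connection m n E}
  {α : Der m n E →ₗ[SmoothFun m M] EndAlg₀ m n E}

/-- Only the horizontal part of a derivation contributes to its products with horizontal ones. -/
lemma apply_onEnd_eq (hD : IsOrthogonal h D) (hα : IsConnectionForm D α) (X : VectorField m M)
    (𝒴 : Der m n E) : h (D.onEnd X) 𝒴 = h (D.onEnd X) (D.onEnd (rho 𝒴)) := by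
  conv_lhs => rw [hα 𝒴]
  rw [map_sub, ad₀_apply, hD, sub_zero]

theorem eq_pullback_add_pullback (hsymm : ∀ 𝒳 𝒴, h 𝒳 𝒴 = h 𝒴 𝒳) (hD : IsOrthogonal h D)
    (hα : IsConnectionForm D α) :
    h = pullback rho (pullback D.onEnd h) + pullback α (pullback ad₀ h) := by
  refine LinearMap.ext fun 𝒳 => LinearMap.ext fun 𝒴 => ?_
  rw [LinearMap.add_apply, LinearMap.add_apply]
  simp only [pullback_apply]
  have h1 : h (ad₀ (α 𝒳)) (D.onEnd (rho 𝒴)) = 0 := by rw [hsymm, ad₀_apply, hD]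
  have h2 : h (ad₀ (α 𝒳)) 𝒴 = - h (ad₀ (α 𝒳)) (ad₀ (α 𝒴)) := by
    conv_lhs => rw [hα 𝒴]
    rw [map_sub, h1, zero_sub]
  conv_lhs => rw [hα 𝒳]
  rw [map_sub, LinearMap.sub_apply, h2, apply_onEnd_eq hD hα, sub_neg_eq_add]

theorem isMetric_pullback_onEnd (hmetric : IsMetric h) (hD : IsOrthogonal h D)
    (hα : IsConnectionForm D α) : IsMetric (pullback D.onEnd h) := by
  refine ⟨fun X Y => hmetric.1 _ _, (injective_iff_map_eq_zero _).2 fun X hX => ?_⟩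
  have h1 : h (D.onEnd X) = 0 := LinearMap.ext fun 𝒴 => by
    rw [apply_onEnd_eq hD hα, ← pullback_apply, hX]
    rfl
  rw [← rho_onEnd D X, (injective_iff_map_eq_zero _).1 hmetric.2 _ h1, map_zero]

theorem isNondegenerateField_pullback_onEnd (hh : IsNondegenerateDer h) (hD : IsOrthogonal h D)
    (hα : IsConnectionForm D α) : IsNondegenerateField (pullback D.onEnd h) := by
  intro x X hX f
  have h1 := hh x (D.onEnd X) (fun 𝒴 => by
    rw [apply_onEnd_eq hD hα]
    exact hX _) (f • 1)
  rw [rho_spec, rho_onEnd] at h1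
  have h2 : trace (X f • (1 : EndAlg m n E)) x = 0 := by
    rw [trace_apply, h1, map_zero]
  rw [map_smul, trace_one, SmoothFun.smul_apply, SmoothFun.algebraMap_apply] at h2
  exact (mul_eq_zero.1 h2).resolve_right (Nat.cast_ne_zero.2 (NeZero.ne n))

/-- If `h` splits along a connection, the connection is `h`-orthogonal to the inner derivations,
as `ρ` kills `ad` and the connection form kills horizontal derivations. -/
lemma isOrthogonal_of_eq_pullback_add_pullback (hα : IsConnectionForm D α)
    {g : LinearMap.BilinForm (SmoothFun m M) (VectorField m M)}
    {μ : LinearMap.BilinForm (SmoothFun m M) (EndAlg₀ m n E)}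
    (hh : h = pullback rho g + pullback α μ) : IsOrthogonal h D := fun X γ => by
  rw [hh, LinearMap.add_apply, LinearMap.add_apply, pullback_apply, pullback_apply,
    hα.apply_onEnd, rho_ad, map_zero, map_zero, LinearMap.zero_apply, add_zero]

lemma eq_of_eq_pullback_add_pullback (hα : IsConnectionForm D α)
    {g : LinearMap.BilinForm (SmoothFun m M) (VectorField m M)}
    {μ : LinearMap.BilinForm (SmoothFun m M) (EndAlg₀ m n E)}
    (hh : h = pullback rho g + pullback α μ) :
    g = pullback D.onEnd h ∧ μ = pullback ad₀ h := by
  constructor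
  · refine LinearMap.ext fun X => LinearMap.ext fun Y => ?_
    rw [hh, pullback_apply, LinearMap.add_apply, LinearMap.add_apply, pullback_apply,
      pullback_apply, hα.apply_onEnd, map_zero, LinearMap.zero_apply, add_zero, rho_onEnd,
      rho_onEnd]
  · refine LinearMap.ext fun γ => LinearMap.ext fun δ => ?_
    rw [hh, pullback_apply, LinearMap.add_apply, LinearMap.add_apply, pullback_apply,
      pullback_apply, hα.apply_ad₀, hα.apply_ad₀, ad₀_apply, rho_ad, map_zero,
      LinearMap.zero_apply, zero_add, map_neg, map_neg, LinearMap.neg_apply, neg_neg]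

end Decomposition

/-- Orthogonal connections induce the same connection on `End E`: the difference of the induced
connections is inner and orthogonal to all inner derivations. -/
theorem IsOrthogonal.onEnd_unique [NeZero n]
    {h : LinearMap.BilinForm (SmoothFun m M) (Der m n E)}
    (hinner : IsNondegenerateInner (pullback ad₀ h)) {D D' : Connection m n E}
    (hD : IsOrthogonal h D) (hD' : IsOrthogonal h D') : D'.onEnd = D.onEnd :=
  LinearMap.ext fun X => by
    obtain ⟨γ, hγ⟩ := exists_eq_ad₀ (𝒴 := D'.onEnd X - D.onEnd X) (by
      rw [map_sub, rho_onEnd, rho_onEnd, sub_self])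
    have h1 : γ = 0 := eq_zero_of_orthogonal hinner fun η => by
      rw [← hγ, map_sub, LinearMap.sub_apply, ad₀_apply, hD, hD', sub_zero]
    rw [h1, map_zero] at hγ
    exact sub_eq_zero.1 hγ

/-! ### Sesquilinear forms and adjoints -/

/-- A `C^∞(M)`-sesquilinear form on `Γ(E)` is represented by an element of `A`. -/
theorem exists_herm_toEnd (S : Sections m n E → Sections m n E → SmoothFun m M)
    (hl : ∀ s s' t, S (s + s') t = S s t + S s' t)
    (hls : ∀ (f : SmoothFun m M) s t, S (f • s) t = f.conj * S s t)
    (hr : ∀ s t t', S s (t + t') = S s t + S s t')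
    (hrs : ∀ (f : SmoothFun m M) s t, S s (f • t) = f * S s t) :
    ∃ T : EndAlg m n E, ∀ s t, S s t = herm s (toEnd T t) := by
  have hloc : ∀ x, ∃ T : EndAlg m n E, ∀ᶠ y in nhds x, ∀ s t,
      S s t y = herm s (toEnd T t) y := fun x => by
    obtain ⟨e, he⟩ := exists_isFrameAt (m := m) (n := n) (E := E) x
    let T : EndAlg m n E := endEquiv.symm
      { toFun := fun t => ∑ j, S (e j) t • e j
        map_add' := fun t t' => by simp only [hr, add_smul, Finset.sum_add_distrib]
        map_smul' := fun f t => by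
          simp only [hrs, mul_smul, Finset.smul_sum, RingHom.id_apply] }
    have hT : ∀ t, toEnd T t = ∑ j, S (e j) t • e j := fun t => toEnd_endEquiv_symm _ t
    refine ⟨T, he.eventually_nhds.mono fun y hy s t => ?_⟩
    obtain ⟨φ, hφy, -, hφ⟩ := exists_cutoff (m := m) hy
    have h1 : φ • s = φ • ∑ j, herm (e j) s • e j := Sections.ext fun z => by
      rcases hφ z with hz | hz
      · simp only [Sections.smul_apply, hz, zero_smul]
      · rw [Sections.smul_apply, Sections.smul_apply, Sections.sum_apply]
        simp only [Sections.smul_apply, hz.sum_eq]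
    have h2 := congrArg (fun u => S u t y) h1
    have h3 : S (∑ j, herm (e j) s • e j) t = ∑ j, S (herm (e j) s • e j) t :=
      map_sum (AddMonoidHom.mk' (fun u => S u t) fun u u' => hl u u' t) _ _
    simp only [hls, h3, SmoothFun.mul_apply, SmoothFun.conj_apply, hφy, star_one, one_mul,
      SmoothFun.sum_apply, star_herm_apply] at h2
    rw [h2, hT, ← hermₗ_apply, map_sum, SmoothFun.sum_apply]
    simp only [map_smul, SmoothFun.smul_apply, hermₗ_apply, mul_comm]
  choose T hT using hloc
  obtain ⟨c, hc⟩ := exists_glue_end T fun x => by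
    filter_upwards [hT x] with y hy
    refine end_apply_eq fun t => section_eq_of_herm (s := toEnd (T x) t) (s' := toEnd (T y) t)
      fun s => ?_
    rw [← hy, (hT y).self_of_nhds]
  refine ⟨c, fun s t => SmoothFun.ext fun x => ?_⟩
  rw [(hT x).self_of_nhds, herm_apply, herm_apply, toEnd_apply_apply, toEnd_apply_apply, hc]

/-- Every element of `A` has an adjoint. -/
lemma exists_adjoint (a : EndAlg m n E) :
    ∃ b : EndAlg m n E, ∀ s t, herm (toEnd a s) t = herm s (toEnd b t) :=
  exists_herm_toEnd (fun s t => herm (toEnd a s) t)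
    (fun s s' t => by rw [map_add, herm_add_left])
    (fun f s t => by rw [map_smul, herm_smul_left])
    (fun s t t' => herm_add_right _ _ _) (fun f s t => herm_smul_right _ _ _)

/-- The reality of a derivation may be checked on global sections. -/
lemma isRealDer_of_herm {𝒳 : Der m n E}
    (h : ∀ a b : EndAlg m n E, (∀ s t, herm (toEnd a s) t = herm s (toEnd b t)) →
      ∀ s t, herm (toEnd (𝒳 a) s) t = herm s (toEnd (𝒳 b) t)) : IsRealDer 𝒳 := by
  intro a b hab x v w
  obtain ⟨s, rfl⟩ := exists_section (m := m) (n := n) x v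
  obtain ⟨t, rfl⟩ := exists_section (m := m) (n := n) x w
  have h1 := h a b (fun s t => SmoothFun.ext fun y => hab y _ _) s t
  exact congrArg (fun u : SmoothFun m M => u x) h1

/-- The inner derivation of a skew-adjoint endomorphism is real. -/
lemma isRealDer_ad {γ : EndAlg m n E}
    (hγ : ∀ s t, herm (toEnd γ s) t = -herm s (toEnd γ t)) : IsRealDer (ad γ) :=
  isRealDer_of_herm fun a b hab s t => by
    simp only [ad_apply, map_sub, map_mul, LinearMap.sub_apply, Module.End.mul_apply,
      herm_sub_left, herm_sub_right, hγ, hab]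
    ring

/-- A real vector field commutes with complex conjugation. -/
lemma IsRealField.apply_conj {X : VectorField m M} (hX : IsRealField X) (f : SmoothFun m M) :
    X f.conj = (X f).conj := SmoothFun.ext fun x => by
  have h1 := hX (f + f.conj) (fun y => by simp) x
  -- `f + f̄` and `i (f - f̄)` are real
  have h2 := hX (Complex.I • (f - f.conj)) (fun y => by
    change (Complex.I * (f y - star (f y))).im = 0
    simp) x
  rw [map_add, SmoothFun.add_apply] at h1
  rw [X.map_smul, map_sub] at h2
  change (Complex.I * (X f x - X f.conj x)).im = 0 at h2
  rw [SmoothFun.conj_apply]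
  simp only [Complex.add_im, Complex.mul_im, Complex.I_re, Complex.I_im, Complex.sub_re,
    zero_mul, one_mul, zero_add] at h1 h2
  apply Complex.ext
  · simpa using (sub_eq_zero.1 h2).symm
  · simpa using eq_neg_of_add_eq_zero_right h1

/-! ### Real metrics and hermitian connections -/

/-- In a unitary unimodular frame, the connection form of a special connection is trace-free. -/
lemma Connection.IsSpecial.sum_herm_eq_zero {D : Connection m n E} (hD : D.IsSpecial)
    (X : VectorField m M) {e : Fin n → Sections m n E} {x : M}
    (he : ∀ᶠ y in nhds x, IsFrameAt e y) : ∑ i, herm (e i) (D.cov X (e i)) x = 0 := by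
  have h1 := congrArg (fun u : SmoothFun m M => u x) (hD X e)
  simp only [SmoothFun.sum_apply] at h1
  rw [field_eq_zero_of_const X (he.mono fun y hy => hy.vol_self)] at h1
  rw [h1]
  refine Finset.sum_congr rfl fun k _ => ?_
  have h2 : (Matrix.of fun i j => herm (e i) (e j) x) = (1 : Matrix (Fin n) (Fin n) ℂ) := by
    ext i j
    rw [Matrix.of_apply, he.self_of_nhds.herm_eq, Matrix.one_apply]
  rw [he.self_of_nhds.vol_update, h2, ← Matrix.cramer_apply, Matrix.cramer_one]
  rfl

/-- Let `T` be self-adjoint, and let `𝒟` be orthogonal to the inner derivations with `𝒟 + ad T`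
real. Then `ad T` is orthogonal to the inner derivations: for skew-adjoint `γ` both
`h(ad T, ad γ) = h(𝒟 + ad T, ad γ)` and `i h(ad T, ad γ) = h(ad (iT), ad γ)` are real. -/
lemma apply_ad_eq_zero_of_isRealForm {h : LinearMap.BilinForm (SmoothFun m M) (Der m n E)}
    (hreal : IsRealForm h) {T : EndAlg m n E}
    (hT : ∀ s t, herm (toEnd T s) t = herm s (toEnd T t)) {𝒟 : Der m n E}
    (h𝒟 : IsRealDer (𝒟 + ad T)) (ho : ∀ γ, h 𝒟 (ad γ) = 0) (γ : EndAlg m n E) :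
    h (ad T) (ad γ) = 0 := by
  let i : SmoothFun m M := algebraMap ℂ (SmoothFun m M) Complex.I
  have hi : i.conj = -i := SmoothFun.ext fun x => by
    change star Complex.I = -Complex.I
    simp
  have hii : i * i = -1 := SmoothFun.ext fun x => Complex.I_mul_I
  have hskew : ∀ γ : EndAlg m n E, (∀ s t, herm (toEnd γ s) t = -herm s (toEnd γ t)) →
      h (ad T) (ad γ) = 0 := fun γ hγ => SmoothFun.ext fun x => by
    have h1 := hreal _ _ h𝒟 (isRealDer_ad hγ) x
    have h2 := hreal (ad (i • T)) (ad γ) (isRealDer_ad fun s t => by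
      rw [map_smul, LinearMap.smul_apply, LinearMap.smul_apply, herm_smul_left, herm_smul_right,
        hT, hi, neg_mul]) (isRealDer_ad hγ) x
    rw [map_add, LinearMap.add_apply, ho, zero_add] at h1
    rw [map_smul, map_smul, LinearMap.smul_apply] at h2
    change (Complex.I * h (ad T) (ad γ) x).im = 0 at h2
    refine Complex.ext ?_ h1
    simpa using h2
  obtain ⟨δ, hδ⟩ := exists_adjoint γ
  have hδ' : ∀ s t, herm (toEnd δ s) t = herm s (toEnd γ t) := fun s t => by
    rw [← conj_herm, ← hδ, conj_herm]
  have h1 := hskew (γ - δ) fun s t => by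
    simp only [map_sub, LinearMap.sub_apply, herm_sub_left, herm_sub_right, hδ, hδ']
    ring
  have h2 := hskew (i • (γ + δ)) fun s t => by
    simp only [map_smul, map_add, LinearMap.smul_apply, LinearMap.add_apply, herm_smul_left,
      herm_smul_right, herm_add_left, herm_add_right, hδ, hδ', hi]
    ring
  rw [map_smul, map_smul, smul_eq_mul] at h2
  have h3 : h (ad T) (ad (γ + δ)) = 0 := by
    have h4 := congrArg (fun u => -(i * u)) h2
    simpa only [← mul_assoc, hii, neg_mul, one_mul, neg_neg, mul_zero, neg_zero] using h4
  rw [map_sub, map_sub] at h1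
  rw [map_add, map_add] at h3
  refine SmoothFun.ext fun x => ?_
  have h5 := congrArg (fun u : SmoothFun m M => u x) (congrArg₂ (· + ·) h1 h3)
  simp only [SmoothFun.add_apply, SmoothFun.sub_apply, SmoothFun.zero_apply] at h5
  rw [SmoothFun.zero_apply]
  linear_combination h5 / 2

/-- If `h` is real, the special orthogonal connection is hermitian. Its defect
`X⟨s, t⟩ - ⟨∇_X s, t⟩ - ⟨s, ∇_X t⟩ = ⟨s, T t⟩` is given by a self-adjoint, trace-free `T`, and
`2 ∇_X + ad T` is a real derivation, which forces `T` to be orthogonal to `A₀`. -/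
theorem Connection.IsSpecial.isHermitian_of_isRealForm
    {h : LinearMap.BilinForm (SmoothFun m M) (Der m n E)}
    (hinner : IsNondegenerateInner (pullback ad₀ h)) (hreal : IsRealForm h)
    {D : Connection m n E} (hD : D.IsSpecial) (ho : IsOrthogonal h D) : D.IsHermitian := by
  intro X hX
  obtain ⟨T, hT⟩ := exists_herm_toEnd
    (fun s t => X (herm s t) - herm (D.cov X s) t - herm s (D.cov X t))
    (fun s s' t => by
      simp only [map_add, herm_add_left]
      ring)
    (fun f s t => by
      simp only [D.leibniz, herm_add_left, herm_smul_left, Derivation.leibniz, smul_eq_mul,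
        hX.apply_conj]
      ring)
    (fun s t t' => by
      simp only [map_add, herm_add_right]
      ring)
    (fun f s t => by
      simp only [D.leibniz, herm_add_right, herm_smul_right, Derivation.leibniz, smul_eq_mul]
      ring)
  have hadj : ∀ s t, herm (toEnd T s) t = herm s (toEnd T t) := fun s t =>
    SmoothFun.ext fun x => by
      rw [← conj_herm, ← hT, ← hT, ← conj_herm t s, hX.apply_conj]
      simp only [SmoothFun.conj_apply, SmoothFun.sub_apply, star_sub, star_herm_apply]
      ring
  have htr : trace T = 0 := SmoothFun.ext fun x => by
    obtain ⟨e, he⟩ := exists_isFrameAt (m := m) (n := n) (E := E) x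
    have h1 : ∀ i, herm (e i) (toEnd T (e i)) x =
        -(star (herm (e i) (D.cov X (e i)) x) + herm (e i) (D.cov X (e i)) x) := fun i => by
      have h2 := congrArg (fun u : SmoothFun m M => u x) (hT (e i) (e i))
      simp only [SmoothFun.sub_apply] at h2
      rw [field_eq_zero_of_const X (he.mono fun y hy => hy.herm_eq i i)] at h2
      rw [← h2, star_herm_apply]
      ring
    rw [he.self_of_nhds.trace_eq]
    simp only [h1]
    rw [Finset.sum_neg_distrib, Finset.sum_add_distrib, ← star_sum,
      hD.sum_herm_eq_zero X he, star_zero, add_zero, neg_zero, SmoothFun.zero_apply]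
  have hDT : IsRealDer (D.onEnd X + D.onEnd X + ad T) := isRealDer_of_herm fun a b hab s t => by
    have hc : ∀ a s, toEnd (D.onEnd X a) s = D.cov X (toEnd a s) - toEnd a (D.cov X s) :=
      fun a s => D.onEnd_spec X a s
    have h1 := hT (toEnd a s) t
    have h2 := hT s (toEnd b t)
    simp only [hab] at h1
    simp only [Der.add_apply, map_add, LinearMap.add_apply, hc, ad_apply, map_sub, map_mul,
      LinearMap.sub_apply, Module.End.mul_apply, herm_add_left, herm_add_right, herm_sub_left,
      herm_sub_right, hab, hadj]
    linear_combination 2 * h2 - 2 * h1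
  have hT0 : (⟨T, mem_traceFree.2 htr⟩ : EndAlg₀ m n E) = 0 :=
    eq_zero_of_orthogonal hinner fun η =>
      apply_ad_eq_zero_of_isRealForm hreal hadj hDT (fun γ => by
        rw [map_add, LinearMap.add_apply, ho X γ, add_zero]) η.1
  have hT1 : T = 0 := congrArg Subtype.val hT0
  intro s t
  have h1 := hT s t
  rw [hT1, map_zero, LinearMap.zero_apply, ← hermₗ_apply s 0, map_zero, sub_sub,
    sub_eq_zero] at h1
  exact h1

end EndBundle

theorem mainTheorem1 (m n : ℕ) [NeZero n] {M : Type*} [TopologicalSpace M] [T2Space M]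
    [ParacompactSpace M] [ChartedSpace (EuclideanSpace ℝ (Fin m)) M] [IsManifold (𝓡 m) ∞ M]
    (E : M → Type*) [∀ x, AddCommGroup (E x)] [∀ x, Module ℂ (E x)] [∀ x, TopologicalSpace (E x)]
    [TopologicalSpace (TotalSpace (Fin n → ℂ) E)] [FiberBundle (Fin n → ℂ) E]
    [VectorBundle ℂ (Fin n → ℂ) E] [SUStructure m n E]
    (h : LinearMap.BilinForm (SmoothFun m M) (Der m n E))
    (hmetric : IsMetric h)
    (hinner : IsNondegenerateInner (pullback ad₀ h)) :
    -- there is a unique connection on `E` orthogonal to the inner derivations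
    (∃! D : Connection m n E, D.IsSpecial ∧ IsOrthogonal h D) ∧
    ∀ D : Connection m n E, D.IsSpecial → IsOrthogonal h D →
      -- any orthogonal connection, even not volume preserving, induces the same one on `End E`
      (∀ D' : Connection m n E, IsOrthogonal h D' → D'.onEnd = D.onEnd) ∧
      -- if `h` is real, it is an `SU(n)`-connection
      (IsRealForm h → D.IsHermitian) ∧
      ∃ α : Der m n E →ₗ[SmoothFun m M] EndAlg₀ m n E,
        IsConnectionForm D α ∧
        (∀ α', IsConnectionForm D α' → α' = α) ∧
        -- `h = ρ^* h^M + α^* h_Int`, with `h^M = ∇^* h` and `h_Int = ad^* h`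
        h = pullback rho (pullback D.onEnd h) +
          pullback α (pullback ad₀ h) ∧
        -- `h^M` is a metric on `M`
        IsMetric (pullback D.onEnd h) ∧
        (IsNondegenerateDer h →
          IsNondegenerateField (pullback D.onEnd h)) ∧
        -- this is the only decomposition of `h` of this type
        ∀ (D' : Connection m n E)
          (α' : Der m n E →ₗ[SmoothFun m M] EndAlg₀ m n E)
          (g : LinearMap.BilinForm (SmoothFun m M) (VectorField m M))
          (μ : LinearMap.BilinForm (SmoothFun m M) (EndAlg₀ m n E)),
          D'.IsSpecial → IsConnectionForm D' α' →
          h = pullback rho g + pullback α' μ →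
          D' = D ∧ α' = α ∧ g = pullback D.onEnd h ∧
            μ = pullback ad₀ h := by
  refine ⟨existsUnique_connection hinner, fun D hDs hDo => ?_⟩
  obtain ⟨α, hα⟩ := exists_connectionForm D
  refine ⟨fun D' hD' => hDo.onEnd_unique hinner hD',
    fun hreal => hDs.isHermitian_of_isRealForm hinner hreal hDo, α, hα, fun α' hα' => hα.unique hα',
    eq_pullback_add_pullback hmetric.1 hDo hα, isMetric_pullback_onEnd hmetric hDo hα,
    fun hh => isNondegenerateField_pullback_onEnd hh hDo hα, fun D' α' g μ hD's hα' hh => ?_⟩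
  have hD : D' = D := (existsUnique_connection hinner).unique
    ⟨hD's, isOrthogonal_of_eq_pullback_add_pullback hα' hh⟩ ⟨hDs, hDo⟩
  subst hD
  exact ⟨rfl, hα.unique hα', eq_of_eq_pullback_add_pullback hα' hh⟩
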